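/- Let $\mathsf G$ be a locally compact (Hausdorff) group with left Haar measure $dx$ and modular function $\Delta$ (normalized by $\int_{\mathsf G}\Delta(x^{-1})f(x^{-1})\,dx=\int_{\mathsf G}f(x)\,dx$), let $\mathfrak A$ be a $C^*$-algebra with multiplier algebra $\mathcal M(\mathfrak A)$ and unitary group $\mathcal{UM}(\mathfrak A)$ of the latter, and let $(\mathsf G,\alpha,\omega,\mathfrak A)$ be a twisted action: $\alpha:\mathsf G\to\mathrm{Aut}(\mathfrak A)$ is continuous for the topology of pointwise norm convergence, $\omega:\mathsf G\times\mathsf G\to\mathcal{UM}(\mathfrak A)$ is strictly continuous, and for all $x,y,z\in\mathsf G$, $a\in\mathfrak A$ (with $\mathsf e$ the identity of $\mathsf G$, and $\alpha_x$ extended to $\mathcal M(\mathfrak A)$) $$\alpha_x(\omega(y,z))\,\omega(x,yz)=\omega(x,y)\,\omega(xy,z),\qquad \alpha_x(\alpha_y(a))\,\omega(x,y)=\omega(x,y)\,\alpha_{xy}(a),$$ $$\omega(x,\mathsf e)=\omega(\mathsf e,y)=1,\qquad \alpha_{\mathsf e}=\mathrm{id}_{\mathfrak A}.$$ Let $L^1_{\alpha,\omega}(\mathsf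 G,\mathfrak A)$ be the Banach space of (classes of) Bochner integrable functions $\Phi:\mathsf G\to\mathfrak A$ with norm $\int_{\mathsf G}\|\Phi(x)\|\,dx$, with product and involution $$(\Phi*\Psi)(x)=\int_{\mathsf G}\Phi(y)\,\alpha_y\big(\Psi(y^{-1}x)\big)\,\omega(y,y^{-1}x)\,dy,\qquad \Phi^*(x)=\Delta(x^{-1})\,\omega(x,x^{-1})^*\,\alpha_x\big(\Phi(x^{-1})^*\big).$$ Let $I\subset L^1_{\alpha,\omega}(\mathsf G,\mathfrak A)$ be a closed two-sided ideal (in particular a linear subspace) of finite codimension. Then $I$ is a $^*$-ideal, that is, $\Phi^*\in I$ for every $\Phi\in I$; the quotient algebra $L^1_{\alpha,\omega}(\mathsf G,\mathfrak A)/I$ is semisimple, that is, its Jacobson radical is zero; and, with the induced involution, this quotient is $^*$-isomorphic to a finite-dimensional $C^*$-algebra. -/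

import Mathlib

section

open MeasureTheory Measure Topology Filter
open scoped NNReal ENNReal

namespace TwistedConvolution
section Modular
variable {G : Type*} [Group G] [TopologicalSpace G] [IsTopologicalGroup G] [LocallyCompactSpace G]
  [MeasurableSpace G] [BorelSpace G]

theorem map_mul_right_eq (μ : Measure G) [μ.IsHaarMeasure] [μ.Regular] (g : G) :
    μ.map (· * g) = modularCharacterFun g • μ := by
  have : (μ.map (· * g)).Regular := Regular.map (Homeomorph.mulRight g)
  rw [modularCharacterFun_eq_haarScalarFactor μ g]
  exact isMulLeftInvariant_eq_smul_of_regular _ μ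

theorem continuous_modularCharacterFun : Continuous (modularCharacterFun : G → ℝ≥0) := by
  let μ : Measure G := haar
  obtain ⟨⟨f, f_cont⟩, f_comp, f_nonneg, f_one⟩ :
    ∃ f : C(G, ℝ), HasCompactSupport f ∧ 0 ≤ f ∧ f 1 ≠ 0 := exists_continuous_nonneg_pos 1
  have hI : ∫ x, f x ∂μ ≠ 0 :=
    ne_of_gt (f_cont.integral_pos_of_hasCompactSupport_nonneg_nonzero f_comp f_nonneg f_one)
  have key : ∀ g : G, (modularCharacterFun g : ℝ) = (∫ y, f (y⁻¹ * g) ∂μ.inv) / ∫ x, f x ∂μ := by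
    intro g
    have h1 : ∫ y, f (y⁻¹ * g) ∂μ.inv = ∫ y, f (y * g) ∂μ := by
      rw [Measure.inv_def]
      have := (Homeomorph.inv G).measurableEmbedding.integral_map (μ := μ)
        (fun y => f (y⁻¹ * g))
      simpa using this
    have h2 : ∫ y, f (y * g) ∂μ = ∫ y, f y ∂(μ.map (· * g)) :=
      ((Homeomorph.mulRight g).measurableEmbedding.integral_map (μ := μ) f).symm
    rw [h1, h2, map_mul_right_eq, integral_smul_nnreal_measure]
    simp [NNReal.smul_def, hI]
  have : Continuous fun g : G => (modularCharacterFun g : ℝ) := by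
    simp_rw [key]
    exact (continuous_integral_apply_inv_mul f_cont f_comp).div_const _
  exact NNReal.isEmbedding_coe.continuous_iff.2 this

theorem map_inv_withDensity_le (μ : Measure G) [μ.IsHaarMeasure] [μ.Regular] :
    ∃ c : ℝ≥0, ((μ.withDensity fun x => (modularCharacterFun x : ℝ≥0∞)).map Inv.inv) ≤ c • μ := by
  set m : G → ℝ≥0∞ := fun x => (modularCharacterFun x : ℝ≥0∞) with hm
  have mcont : Continuous (modularCharacterFun : G → ℝ≥0) := continuous_modularCharacterFun
  have mmeas : Measurable m := mcont.measurable.coe_nnreal_ennreal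
  set ν := (μ.withDensity m).map Inv.inv with hν
  have hνl : ∀ f : G → ℝ≥0∞, Measurable f → ∫⁻ x, f x ∂ν = ∫⁻ x, m x * f x⁻¹ ∂μ := by
    intro f hf
    rw [hν, lintegral_map hf measurable_inv,
      lintegral_withDensity_eq_lintegral_mul μ mmeas (g := fun x => f x⁻¹)
        (hf.comp measurable_inv)]
    rfl
  have hinv : ν.IsMulLeftInvariant := by
    refine ⟨fun g => ?_⟩
    ext s hs
    have hs1 : Measurable (s.indicator (1 : G → ℝ≥0∞)) := measurable_one.indicator hs
    rw [← lintegral_indicator_one (hs), ← lintegral_indicator_one hs,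
      lintegral_map hs1 (measurable_const_mul g), hνl (fun x => s.indicator 1 (g * x)) (hs1.comp (measurable_const_mul g)),
      hνl _ hs1]
    set F : G → ℝ≥0∞ := fun x => m x * s.indicator (1 : G → ℝ≥0∞) x⁻¹ with hF
    have hFm : Measurable F := mmeas.mul (hs1.comp measurable_inv)
    have e1 : ∀ x, m x * s.indicator (1 : G → ℝ≥0∞) (g * x⁻¹) = m g * F (x * g⁻¹) := by
      intro x
      have : m x = m g * m (x * g⁻¹) := by
        simp only [hm]
        rw [← ENNReal.coe_mul, ← modularCharacterFun_map_mul, modularCharacterFun_map_mul,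
          modularCharacterFun_map_mul, mul_comm, mul_assoc, ← modularCharacterFun_map_mul]
        simp [modularCharacterFun_map_one]
      rw [hF]
      simp only [mul_inv_rev, inv_inv]
      rw [this, mul_assoc]
    simp_rw [e1]
    rw [lintegral_const_mul (f := fun x => F (x * g⁻¹)) _ (hFm.comp (measurable_mul_const g⁻¹)),
      ← lintegral_map hFm (measurable_mul_const g⁻¹), map_mul_right_eq, lintegral_smul_measure]
    rw [← mul_one (∫⁻ x, F x ∂μ), ENNReal.smul_def, smul_eq_mul, ← mul_assoc, ← mul_assoc, mul_one]
    have : m g * (modularCharacterFun g⁻¹ : ℝ≥0∞) = 1 := by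
      simp only [hm]
      rw [← ENNReal.coe_mul, ← modularCharacterFun_map_mul]
      simp [modularCharacterFun_map_one]
    rw [this, one_mul, mul_one]
  have hνs : ∀ s, ν s = μ.withDensity m s⁻¹ := fun s =>
    (Homeomorph.inv G).measurableEmbedding.map_apply _ s
  have hfin : IsFiniteMeasureOnCompacts ν := by
    refine ⟨fun K hK => ?_⟩
    have : IsLocallyFiniteMeasure (μ.withDensity m) := IsLocallyFiniteMeasure.withDensity_coe mcont
    rw [hνs]
    exact hK.inv.measure_lt_top
  have hac : μ ≪ μ.withDensity m :=
    withDensity_absolutelyContinuous' mmeas.aemeasurable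
      (Eventually.of_forall fun x => by
        simpa [hm] using (modularCharacterFun_pos x).ne')
  have hpos : ν.IsOpenPosMeasure := by
    refine ⟨fun U hU hne h0 => ?_⟩
    rw [hνs] at h0
    exact hU.inv.measure_ne_zero μ hne.inv (hac h0)
  have : ν.IsHaarMeasure := {}
  have hle : ν ≤ haarScalarFactor ν μ • μ := by
    refine Measure.le_iff'.2 fun s => ?_
    rw [Set.measure_eq_iInf_isOpen s (haarScalarFactor ν μ • μ)]
    refine le_iInf₂ fun U hU => le_iInf fun hUo => ?_
    calc ν s ≤ ν U := measure_mono hU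
      _ = _ := by
        rw [measure_isHaarMeasure_eq_smul_of_isOpen ν μ hUo]; rfl
  exact ⟨_, hle⟩

/-- Inversion maps null sets of a regular Haar measure to null sets. -/
theorem tendsto_inv_ae (μ : Measure G) [μ.IsHaarMeasure] [μ.Regular] :
    Tendsto (fun x : G => x⁻¹) (ae μ) (ae μ) := by
  obtain ⟨c, hc⟩ := map_inv_withDensity_le μ
  have hac : μ ≪ μ.withDensity fun x => (modularCharacterFun x : ℝ≥0∞) :=
    withDensity_absolutelyContinuous'
      continuous_modularCharacterFun.measurable.coe_nnreal_ennreal.aemeasurable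
      (Eventually.of_forall fun x => by simpa using (modularCharacterFun_pos x).ne')
  intro s hs
  rw [mem_map, mem_ae_iff]
  apply hac
  have h1 : (c • μ) sᶜ = 0 := by rw [Measure.smul_apply, mem_ae_iff.1 hs, smul_zero]
  have h2 := le_antisymm ((hc sᶜ).trans h1.le) bot_le
  have h3 := (Homeomorph.inv G).measurableEmbedding.map_apply
    (μ.withDensity fun x => (modularCharacterFun x : ℝ≥0∞)) sᶜ
  exact h3.symm.trans h2

theorem integrable_modular_smul_inv (μ : Measure G) [μ.IsHaarMeasure] [μ.Regular]
    {E : Type*} [NormedAddCommGroup E] [NormedSpace ℝ E] {f : G → E} (hf : Integrable f μ) :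
    Integrable (fun x => modularCharacterFun x • f x⁻¹) μ := by
  obtain ⟨c, hc⟩ := map_inv_withDensity_le μ
  have h1 : Integrable f ((μ.withDensity fun x => (modularCharacterFun x : ℝ≥0∞)).map Inv.inv) :=
    Integrable.mono_measure hf.smul_measure_nnreal hc
  have h2 := ((Homeomorph.inv G).measurableEmbedding.integrable_map_iff
    (μ := μ.withDensity fun x => (modularCharacterFun x : ℝ≥0∞)) (g := f)).1 h1
  exact (integrable_withDensity_iff_integrable_smul
    continuous_modularCharacterFun.measurable).1 h2

theorem tendsto_inv_mul_ae (μ : Measure G) [μ.IsHaarMeasure] [μ.Regular] (x : G) :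
    Tendsto (fun y : G => y⁻¹ * x) (ae μ) (ae μ) := by
  have h := (tendsto_inv_ae μ).comp
    (measurePreserving_mul_left μ x⁻¹).quasiMeasurePreserving.tendsto_ae
  refine h.congr fun y => ?_
  simp
end Modular
end TwistedConvolution
open scoped MultiplierAlgebra

namespace TwistedConvolution
section Alg
variable {A : Type*} [NonUnitalCStarAlgebra A]

/-- The continuous linear map underlying a *-automorphism of a C*-algebra. -/
noncomputable def autCLM (e : A ≃⋆ₐ[ℂ] A) : A →L[ℂ] A :=
  LinearMap.mkContinuous
    { toFun := e
      map_add' := map_add e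
      map_smul' := fun c a => map_smul e c a } 1
    (fun a => by simpa using (StarAlgEquiv.norm_map e a).le)

@[simp] theorem autCLM_apply (e : A ≃⋆ₐ[ℂ] A) (a : A) : autCLM e a = e a := rfl

/-- The canonical extension of a *-automorphism `e` of `A` to the multiplier algebra `M(A)`,
`m ↦ e ∘ m ∘ e⁻¹`. -/
noncomputable def extendAut (e : A ≃⋆ₐ[ℂ] A) (m : 𝓜(ℂ, A)) : 𝓜(ℂ, A) where
  fst := autCLM e ∘L m.fst ∘L autCLM e.symm
  snd := autCLM e ∘L m.snd ∘L autCLM e.symm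
  central x y := by
    have h := congrArg e (m.central (e.symm x) (e.symm y))
    simpa using h

theorem eq_of_forall_mul_eq {a b : A} (h : ∀ c, a * c = b * c) : a = b := by
  have h1 : (a - b) * star (a - b) = 0 := by rw [sub_mul, h, sub_self]
  exact sub_eq_zero.1 (CStarRing.mul_star_self_eq_zero_iff _ |>.1 h1)

theorem snd_mul (u : 𝓜(ℂ, A)) (a b : A) : u.snd (a * b) = a * u.snd b :=
  eq_of_forall_mul_eq fun c => by rw [u.central, mul_assoc, mul_assoc, u.central]

theorem eq_of_forall_mul_eq' {a b : A} (h : ∀ c, c * a = c * b) : a = b := by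
  have h1 : star (a - b) * (a - b) = 0 := by rw [mul_sub, h, sub_self]
  exact sub_eq_zero.1 (CStarRing.star_mul_self_eq_zero_iff _ |>.1 h1)

theorem fst_mul (u : 𝓜(ℂ, A)) (a b : A) : u.fst (a * b) = u.fst a * b :=
  eq_of_forall_mul_eq' fun c => by rw [← u.central, ← mul_assoc, ← mul_assoc, u.central]

theorem norm_unitary_le (u : unitary 𝓜(ℂ, A)) : ‖(u : 𝓜(ℂ, A))‖ ≤ 1 := by
  rcases subsingleton_or_nontrivial 𝓜(ℂ, A) with h | h
  · rw [Subsingleton.elim (u : 𝓜(ℂ, A)) 0, norm_zero]; exact zero_le_one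
  · exact (CStarRing.norm_coe_unitary u).le

theorem norm_snd_le (u : unitary 𝓜(ℂ, A)) (a : A) : ‖(u : 𝓜(ℂ, A)).snd a‖ ≤ ‖a‖ := by
  refine ((u : 𝓜(ℂ, A)).snd.le_opNorm a).trans ?_
  rw [DoubleCentralizer.norm_snd]
  exact mul_le_of_le_one_left (norm_nonneg _) (norm_unitary_le u)

theorem norm_fst_le (u : unitary 𝓜(ℂ, A)) (a : A) : ‖(u : 𝓜(ℂ, A)).fst a‖ ≤ ‖a‖ := by
  refine ((u : 𝓜(ℂ, A)).fst.le_opNorm a).trans ?_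
  rw [DoubleCentralizer.norm_fst]
  exact mul_le_of_le_one_left (norm_nonneg _) (norm_unitary_le u)

end Alg
end TwistedConvolution
open TwistedConvolution

/-- A (continuous) twisted action `(G, α, ω, A)` of a topological group `G` on a C*-algebra `A`:
`α : G → Aut(A)` is continuous for the topology of pointwise norm convergence,
`ω : G × G → UM(A)` is continuous for the strict topology of the unitary group of the
multiplier algebra, and the twisted action identities hold.
For a multiplier `m` and `a` in `A`, `m.fst a` is `m a` and `m.snd a` is `a m`. -/
structure TwistedAction (G A : Type*) [Group G] [TopologicalSpace G]
    [NonUnitalCStarAlgebra A] where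
  /-- the automorphisms `α_x` -/
  α : G → (A ≃⋆ₐ[ℂ] A)
  /-- the unitary multipliers `ω(x, y)` -/
  ω : G → G → unitary 𝓜(ℂ, A)
  continuous_α : ∀ a : A, Continuous fun x : G => α x a
  continuous_ω_left : ∀ a : A, Continuous fun p : G × G => (ω p.1 p.2 : 𝓜(ℂ, A)).fst a
  continuous_ω_right : ∀ a : A, Continuous fun p : G × G => (ω p.1 p.2 : 𝓜(ℂ, A)).snd a
  cocycle : ∀ x y z : G,
    extendAut (α x) (ω y z) * (ω x (y * z) : 𝓜(ℂ, A)) = (ω x y : 𝓜(ℂ, A)) * ω (x * y) z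
  twist : ∀ (x y : G) (a : A),
    ((α x (α y a) : A) : 𝓜(ℂ, A)) * (ω x y : 𝓜(ℂ, A)) =
      (ω x y : 𝓜(ℂ, A)) * ((α (x * y) a : A) : 𝓜(ℂ, A))
  ω_one_right : ∀ x : G, ω x 1 = 1
  ω_one_left : ∀ y : G, ω 1 y = 1
  α_one : ∀ a : A, α 1 a = a

namespace TwistedAction
variable {G A : Type*} [Group G] [TopologicalSpace G]
  [NonUnitalCStarAlgebra A] (T : TwistedAction G A)

/-- The integrand `a α_y(b) ω(y, y⁻¹x)` of the twisted convolution. -/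
noncomputable def kernel (y x : G) (a b : A) : A :=
  (T.ω y (y⁻¹ * x) : 𝓜(ℂ, A)).snd (a * T.α y b)

theorem twist_apply (x y : G) (a : A) :
    (T.ω x y : 𝓜(ℂ, A)).snd (T.α x (T.α y a)) = (T.ω x y : 𝓜(ℂ, A)).fst (T.α (x * y) a) := by
  refine eq_of_forall_mul_eq fun c => ?_
  have h : T.α x (T.α y a) * (T.ω x y : 𝓜(ℂ, A)).fst c =
      (T.ω x y : 𝓜(ℂ, A)).fst (T.α (x * y) a * c) :=
    congrArg (fun m : 𝓜(ℂ, A) => m.fst c) (T.twist x y a)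
  rw [DoubleCentralizer.central, h, fst_mul]

theorem kernel_assoc (y z w : G) (a b c : A) :
    T.kernel y (y * (z * w)) a (T.kernel z (z * w) b c) =
      T.kernel (y * z) (y * z * w) (T.kernel y (y * z) a b) c := by
  simp only [kernel, inv_mul_cancel_left]
  have e2 : T.α y ((T.ω z w : 𝓜(ℂ, A)).snd (b * T.α z c)) =
    (extendAut (T.α y) (T.ω z w)).snd (T.α y (b * T.α z c)) := by
    simp [extendAut]
  have e3 : (T.ω y z : 𝓜(ℂ, A)).snd (a * T.α y b) * T.α (y * z) c =
      (T.ω y z : 𝓜(ℂ, A)).snd (a * T.α y b * T.α y (T.α z c)) := by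
    rw [DoubleCentralizer.central, ← twist_apply, snd_mul]
  have e4 : (T.ω y (z * w) : 𝓜(ℂ, A)).snd
      ((extendAut (T.α y) (T.ω z w)).snd (a * T.α y b * T.α y (T.α z c))) =
      (T.ω (y * z) w : 𝓜(ℂ, A)).snd ((T.ω y z : 𝓜(ℂ, A)).snd
        (a * T.α y b * T.α y (T.α z c))) :=
    congrArg (fun m : 𝓜(ℂ, A) => m.snd (a * T.α y b * T.α y (T.α z c))) (T.cocycle y z w)
  rw [e2, e3, ← e4, ← snd_mul, map_mul (T.α y), mul_assoc]

theorem norm_kernel_le (y x : G) (a b : A) : ‖T.kernel y x a b‖ ≤ ‖a‖ * ‖b‖ := by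
  refine (norm_snd_le _ _).trans ((norm_mul_le _ _).trans ?_)
  rw [StarAlgEquiv.norm_map]

theorem continuous_α_prod : Continuous fun p : G × A => T.α p.1 p.2 :=
  continuous_prod_of_continuous_lipschitzWith' _ 1
    (fun x => (StarAlgEquiv.isometry (T.α x)).lipschitz) T.continuous_α

theorem continuous_ω_right_prod :
    Continuous fun p : (G × G) × A => (T.ω p.1.1 p.1.2 : 𝓜(ℂ, A)).snd p.2 :=
  continuous_prod_of_continuous_lipschitzWith' _ 1
    (fun x => LipschitzWith.of_dist_le_mul fun a b => by
      simp only [dist_eq_norm, NNReal.coe_one, one_mul]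
      rw [← map_sub]
      exact norm_snd_le _ _) T.continuous_ω_right

theorem continuous_ω_left_prod :
    Continuous fun p : (G × G) × A => (T.ω p.1.1 p.1.2 : 𝓜(ℂ, A)).fst p.2 :=
  continuous_prod_of_continuous_lipschitzWith' _ 1
    (fun x => LipschitzWith.of_dist_le_mul fun a b => by
      simp only [dist_eq_norm, NNReal.coe_one, one_mul]
      rw [← map_sub]
      exact norm_fst_le _ _) T.continuous_ω_left

theorem continuous_kernel [IsTopologicalGroup G] :
    Continuous fun p : (G × G) × (A × A) => T.kernel p.1.1 p.1.2 p.2.1 p.2.2 := by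
  have h1 : Continuous fun p : (G × G) × (A × A) => T.α p.1.1 p.2.2 :=
    T.continuous_α_prod.comp (f := fun p : (G × G) × (A × A) => (p.1.1, p.2.2)) (by fun_prop)
  exact T.continuous_ω_right_prod.comp
    (f := fun p : (G × G) × (A × A) => ((p.1.1, p.1.1⁻¹ * p.1.2), p.2.1 * T.α p.1.1 p.2.2))
    (by fun_prop)

theorem kernel_add_left (y x : G) (a a' b : A) :
    T.kernel y x (a + a') b = T.kernel y x a b + T.kernel y x a' b := by
  simp [kernel, add_mul]
theorem kernel_add_right (y x : G) (a b b' : A) :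
    T.kernel y x a (b + b') = T.kernel y x a b + T.kernel y x a b' := by
  simp [kernel, mul_add]
theorem kernel_smul_left (c : ℂ) (y x : G) (a b : A) :
    T.kernel y x (c • a) b = c • T.kernel y x a b := by
  simp [kernel, smul_mul_assoc]
theorem kernel_smul_right (c : ℂ) (y x : G) (a b : A) :
    T.kernel y x a (c • b) = c • T.kernel y x a b := by
  simp [kernel, mul_smul_comm]
theorem kernel_zero_left (y x : G) (b : A) : T.kernel y x 0 b = 0 := by simp [kernel]
theorem kernel_zero_right (y x : G) (a : A) : T.kernel y x a 0 = 0 := by simp [kernel]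

/-- `kernel y x` as a continuous linear map in the right argument. -/
noncomputable def kernelRight (y x : G) (a : A) : A →L[ℂ] A :=
  LinearMap.mkContinuous
    { toFun := T.kernel y x a
      map_add' := T.kernel_add_right y x a
      map_smul' := fun c b => T.kernel_smul_right c y x a b } ‖a‖ (T.norm_kernel_le y x a)

/-- `kernel y x` as a continuous linear map in the left argument. -/
noncomputable def kernelLeft (y x : G) (b : A) : A →L[ℂ] A :=
  LinearMap.mkContinuous
    { toFun := fun a => T.kernel y x a b
      map_add' := fun a a' => T.kernel_add_left y x a a' b
      map_smul' := fun c a => T.kernel_smul_left c y x a b } ‖b‖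
    (fun a => (T.norm_kernel_le y x a b).trans_eq (mul_comm _ _))

end TwistedAction

namespace TwistedConvolution

section Series
variable {X E : Type*} {_ : MeasurableSpace X} {μ : Measure X} [NormedAddCommGroup E]
  {ι : Type*}

theorem tsum_enorm_ne_top {f : ι → X → E} (hf : ∀ i, Integrable (f i) μ)
    (hs : Summable fun i => ∫ x, ‖f i x‖ ∂μ) : ∑' i, eLpNorm (f i) 1 μ ≠ ∞ := by
  have : ∀ i, eLpNorm (f i) 1 μ = ENNReal.ofReal (∫ x, ‖f i x‖ ∂μ) := fun i => by
    rw [eLpNorm_one_eq_lintegral_enorm, ofReal_integral_norm_eq_lintegral_enorm (hf i)]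
  simp_rw [this]
  exact hs.tsum_ofReal_ne_top

theorem ae_summable_norm [Countable ι] {f : ι → X → E} (hf : ∀ i, Integrable (f i) μ)
    (hs : Summable fun i => ∫ x, ‖f i x‖ ∂μ) : ∀ᵐ x ∂μ, Summable fun i => ‖f i x‖ :=
  summable_norm_of_tsum_eLpNorm_ne_top le_rfl (fun i => (hf i).1) (tsum_enorm_ne_top hf hs)

theorem integrable_of_ae_hasSum [Countable ι] [NormedSpace ℝ E] [CompleteSpace E] {f : ι → X → E} {g : X → E} (hf : ∀ i, Integrable (f i) μ)
    (hs : Summable fun i => ∫ x, ‖f i x‖ ∂μ) (hg : ∀ᵐ x ∂μ, HasSum (fun i => f i x) (g x)) :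
    Integrable g μ ∧ HasSum (fun i => ∫ x, f i x ∂μ) (∫ x, g x ∂μ) ∧
      ∫ x, ‖g x‖ ∂μ ≤ ∑' i, ∫ x, ‖f i x‖ ∂μ := by
  have hfL : ∀ i, (hf i).toL1 =ᵐ[μ] f i := fun i => (hf i).coeFn_toL1
  have hn : ∑' i, ‖(hf i).toL1‖ₑ ≠ ∞ := by
    have := tsum_enorm_ne_top hf hs
    simpa only [Integrable.enorm_toL1, eLpNorm_one_eq_lintegral_enorm] using this
  have h1 := Lp.hasSum_coeFn_tsum hn
  have h2 : g =ᵐ[μ] (∑' i, (hf i).toL1 : Lp E 1 μ) := by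
    filter_upwards [h1, hg, ae_all_iff.2 hfL] with x hx hgx hfx
    simp_rw [hfx] at hx
    exact hgx.unique hx
  have hgi : Integrable g μ := (L1.integrable_coeFn _).congr h2.symm
  refine ⟨hgi, ?_, ?_⟩
  · have h3 := hasSum_integral_of_summable_integral_norm hf hs
    have h4 : ∫ x, g x ∂μ = ∫ x, ∑' i, f i x ∂μ :=
      integral_congr_ae (hg.mono fun x hx => hx.tsum_eq.symm)
    rwa [h4]
  · have h5 : ∫ x, ‖g x‖ ∂μ = ‖(∑' i, (hf i).toL1 : Lp E 1 μ)‖ := by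
      rw [L1.norm_eq_integral_norm]
      exact integral_congr_ae (h2.mono fun x hx => by simp only [hx])
    have h6 : ∀ i, ‖(hf i).toL1‖ = ∫ x, ‖f i x‖ ∂μ := fun i => by
      rw [L1.norm_eq_integral_norm]
      exact integral_congr_ae ((hfL i).mono fun x hx => by simp only [hx])
    rw [h5]
    simp_rw [← h6] at hs ⊢
    exact norm_tsum_le_tsum_norm hs

end Series

section Dense
variable {X E : Type*} [TopologicalSpace X] [R1Space X] [LocallyCompactSpace X]
  [MeasurableSpace X] [BorelSpace X] {μ : Measure X} [μ.Regular] [NormedAddCommGroup E]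
  [NormedSpace ℝ E]

theorem exists_hasCompactSupport_near {Φ : X → E} (hΦ : Integrable Φ μ) {δ : ℝ} (hδ : 0 < δ) :
    ∃ g : X → E, Continuous g ∧ HasCompactSupport g ∧ Integrable g μ ∧
      ∫ x, ‖Φ x - g x‖ ∂μ ≤ δ := by
  have h0 : (ENNReal.ofReal δ) ≠ 0 := by simpa using hδ
  have h0P : ∀ (c : E) ⦃t : Set X⦄, MeasurableSet t → μ t < ∞ → ∀ {ε : ℝ≥0∞}, ε ≠ 0 →
      ∃ g : X → E, eLpNorm (g - t.indicator fun _ => c) 1 μ ≤ ε ∧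
        (Continuous g ∧ HasCompactSupport g) := by
    intro c t ht htμ ε hε
    obtain ⟨η, hη, hηε⟩ := ENNReal.exists_nnreal_pos_mul_lt
      (a := 2 * ‖c‖ₑ) (ENNReal.mul_ne_top ENNReal.ofNat_ne_top enorm_ne_top) hε
    have hη0 : (η : ℝ≥0∞) ≠ 0 := by simpa using hη.ne'
    obtain ⟨K, Kt, Kc, Kcl, hK⟩ := ht.exists_isCompact_isClosed_sdiff_lt htμ.ne hη0
    obtain ⟨U, hUK, hUo, -, hU⟩ :=
      Kcl.measurableSet.exists_isOpen_sdiff_lt (Kc.measure_lt_top (μ := μ)).ne hη0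
    obtain ⟨f, f1, f2, f3, f4⟩ := exists_continuousMap_one_of_isCompact_subset_isOpen Kc hUo hUK
    refine ⟨fun x => f x • c, ?_, f.continuous.smul continuous_const, ?_⟩
    · rw [eLpNorm_one_eq_lintegral_enorm]
      set V := (U \ K) ∪ (t \ K) with hV
      have hVm : MeasurableSet V :=
        (hUo.measurableSet.diff Kcl.measurableSet).union (ht.diff Kcl.measurableSet)
      calc ∫⁻ x, ‖((fun x => f x • c) - t.indicator fun _ => c) x‖ₑ ∂μ
          ≤ ∫⁻ x, V.indicator (fun _ => ‖c‖ₑ) x ∂μ := by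
            refine lintegral_mono fun x => ?_
            by_cases hxK : x ∈ K
            · simp [f1 hxK, Kt hxK]
            by_cases hxV : x ∈ V
            · simp only [Set.indicator_of_mem hxV, Pi.sub_apply]
              rw [enorm_le_iff_norm_le]
              have h01 := f4 x
              by_cases hxt : x ∈ t
              · rw [Set.indicator_of_mem hxt]
                have : f x • c - c = (f x - 1) • c := by rw [sub_smul, one_smul]
                rw [this, norm_smul]
                refine mul_le_of_le_one_left (norm_nonneg _) ?_
                rw [Real.norm_eq_abs, abs_le]
                constructor <;> linarith [h01.1, h01.2]
              · rw [Set.indicator_of_notMem hxt, sub_zero, norm_smul]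
                refine mul_le_of_le_one_left (norm_nonneg _) ?_
                rw [Real.norm_eq_abs, abs_le]
                constructor <;> linarith [h01.1, h01.2]
            · have hxU : x ∉ U := fun h => hxV (Or.inl ⟨h, hxK⟩)
              have hxt : x ∉ t := fun h => hxV (Or.inr ⟨h, hxK⟩)
              have : f x = 0 := image_eq_zero_of_notMem_tsupport fun h => hxU (f3 h)
              simp [this, hxt]
        _ = ‖c‖ₑ * μ V := by rw [lintegral_indicator_const hVm]
        _ ≤ ‖c‖ₑ * (η + η) := by
            gcongr
            exact (measure_union_le _ _).trans (add_le_add hU.le hK.le)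
        _ = η * (2 * ‖c‖ₑ) := by ring
        _ ≤ ε := hηε.le
    · exact HasCompactSupport.smul_right (f := f) (f' := fun _ => c) f2
  obtain ⟨g, hg, g1, g2⟩ := (memLp_one_iff_integrable.2 hΦ).induction_dense ENNReal.one_ne_top
    (fun g : X → E => Continuous g ∧ HasCompactSupport g) h0P
    (fun f g hf hg => ⟨hf.1.add hg.1, hf.2.add hg.2⟩)
    (fun f hf => (hf.1.integrable_of_hasCompactSupport hf.2).1) h0
  have hgi : Integrable g μ := g1.integrable_of_hasCompactSupport g2
  refine ⟨g, g1, g2, hgi, ?_⟩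
  rw [eLpNorm_one_eq_lintegral_enorm, ← ofReal_integral_norm_eq_lintegral_enorm (hΦ.sub hgi)] at hg
  simpa using (ENNReal.ofReal_le_ofReal_iff hδ.le).1 hg

/-- An integrable function is an absolutely convergent series of continuous compactly supported
functions. -/
theorem exists_series [CompleteSpace E] {Φ : X → E} (hΦ : Integrable Φ μ) {ε : ℝ} (hε : 0 < ε) :
    ∃ φ : ℕ → X → E, (∀ n, Continuous (φ n)) ∧ (∀ n, HasCompactSupport (φ n)) ∧
      (Summable fun n => ∫ x, ‖φ n x‖ ∂μ) ∧ ∑' n, ∫ x, ‖φ n x‖ ∂μ ≤ ∫ x, ‖Φ x‖ ∂μ + ε ∧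
      ∀ᵐ x ∂μ, HasSum (fun n => φ n x) (Φ x) := by
  let S : AddSubgroup (Lp E 1 μ) :=
    { carrier := {f | ∃ g : X → E, Continuous g ∧ HasCompactSupport g ∧ f =ᵐ[μ] g}
      add_mem' := by
        rintro a b ⟨g, h1, h2, h3⟩ ⟨g', h1', h2', h3'⟩
        exact ⟨g + g', h1.add h1', h2.add h2', (Lp.coeFn_add a b).trans (h3.add h3')⟩
      zero_mem' := ⟨0, continuous_zero, HasCompactSupport.zero, Lp.coeFn_zero _ _ _⟩
      neg_mem' := by
        rintro a ⟨g, h1, h2, h3⟩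
        exact ⟨-g, h1.neg, h2.neg, (Lp.coeFn_neg a).trans h3.neg⟩ }
  have hcl : hΦ.toL1 ∈ closure (S : Set (Lp E 1 μ)) := by
    refine Metric.mem_closure_iff.2 fun δ hδ => ?_
    obtain ⟨g, g3, g1, g4, g2⟩ := exists_hasCompactSupport_near hΦ (half_pos hδ)
    refine ⟨g4.toL1, ⟨g, g3, g1, g4.coeFn_toL1⟩, ?_⟩
    rw [dist_eq_norm, ← Integrable.toL1_sub _ _ hΦ g4, L1.norm_eq_integral_norm]
    have : ∫ x, ‖(hΦ.sub g4).toL1 (Φ - g) x‖ ∂μ = ∫ x, ‖Φ x - g x‖ ∂μ :=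
      integral_congr_ae ((hΦ.sub g4).coeFn_toL1.mono fun x hx => by simp only [hx, Pi.sub_apply])
    linarith
  obtain ⟨v, hv, hvS, hv0, hvn⟩ := controlled_sum_of_mem_closure hcl
    (b := fun n => ε / 2 / 2 ^ n) (fun n => by positivity)
  choose φ φ1 φ2 φ3 using hvS
  have hnorm : ∀ n, ‖v n‖ = ∫ x, ‖φ n x‖ ∂μ := fun n => by
    rw [L1.norm_eq_integral_norm]
    exact integral_congr_ae ((φ3 n).mono fun x hx => by simp only [hx])
  have hle : ∀ n, ‖v n‖ ≤ (if n = 0 then ‖hΦ.toL1‖ else 0) + ε / 2 / 2 ^ n := by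
    intro n
    rcases Nat.eq_zero_or_pos n with rfl | hn
    · simp only [if_true]
      have := norm_sub_norm_le (v 0) hΦ.toL1
      rw [neg_add_eq_sub, norm_sub_rev] at hv0
      linarith
    · simp only [hn.ne', if_false, zero_add]
      exact (hvn n hn).le
  have hs2 : HasSum (fun n : ℕ => ε / 2 / 2 ^ n) ε :=
    hasSum_geometric_two' ε
  have hs1 : HasSum (fun n : ℕ => if n = 0 then ‖hΦ.toL1‖ else 0) ‖hΦ.toL1‖ := hasSum_ite_eq 0 _
  have hs3 := hs1.add hs2
  have hvs : Summable fun n => ‖v n‖ :=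
    Summable.of_nonneg_of_le (fun n => norm_nonneg _) hle hs3.summable
  have hΦn : ‖hΦ.toL1‖ = ∫ x, ‖Φ x‖ ∂μ := by
    rw [L1.norm_eq_integral_norm]
    exact integral_congr_ae (hΦ.coeFn_toL1.mono fun x hx => by simp only [hx])
  have hvsum : HasSum v hΦ.toL1 := by
    have h1 := hvs.of_norm.hasSum
    have h2 := h1.tendsto_sum_nat.comp (tendsto_add_atTop_nat 1)
    rwa [tendsto_nhds_unique h2 hv] at h1
  refine ⟨φ, φ1, φ2, ?_, ?_, ?_⟩
  · simpa only [hnorm] using hvs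
  · simp_rw [← hnorm]
    have := hvs.tsum_le_of_sum_le (fun s => ?_) (a₂ := ∫ x, ‖Φ x‖ ∂μ + ε)
    · exact this
    · have h1 := hs3.summable.sum_le_tsum s (fun n _ => (norm_nonneg _).trans (hle n))
      rw [hs3.tsum_eq] at h1
      have h2 := Finset.sum_le_sum (s := s) fun n _ => hle n
      linarith
  · have hn : ∑' i, ‖v i‖ₑ ≠ ∞ := by
      simp_rw [← ofReal_norm]
      exact hvs.tsum_ofReal_ne_top
    filter_upwards [Lp.hasSum_coeFn_tsum hn, ae_all_iff.2 φ3, hΦ.coeFn_toL1] with x h1 h2 h3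
    rw [hvsum.tsum_eq, h3] at h1
    simpa only [h2] using h1
end Dense
end TwistedConvolution

namespace TwistedAction
variable {G A : Type*} [Group G] [TopologicalSpace G] [IsTopologicalGroup G]
  [NonUnitalCStarAlgebra A] (T : TwistedAction G A)

theorem continuous_integrand {φ ψ : G → A} (hφ : Continuous φ) (hψ : Continuous ψ) :
    Continuous (Function.uncurry fun y x : G => T.kernel y x (φ y) (ψ (y⁻¹ * x))) :=
  T.continuous_kernel.comp (f := fun p : G × G => ((p.1, p.2), (φ p.1, ψ (p.1⁻¹ * p.2))))
    (by fun_prop)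

theorem hasCompactSupport_integrand {φ ψ : G → A} (hφ : HasCompactSupport φ)
    (hψ : HasCompactSupport ψ) :
    HasCompactSupport (Function.uncurry fun y x : G => T.kernel y x (φ y) (ψ (y⁻¹ * x))) := by
  have hK : IsCompact ((fun p : G × G => (p.1, p.1 * p.2)) '' (tsupport φ ×ˢ tsupport ψ)) :=
    (IsCompact.prod hφ hψ).image (by fun_prop)
  refine HasCompactSupport.intro hK fun p hp => ?_
  by_contra h
  apply hp
  have h1 : φ p.1 ≠ 0 := fun h0 => h (by simp [Function.uncurry, h0, kernel_zero_left])
  have h2 : ψ (p.1⁻¹ * p.2) ≠ 0 := fun h0 => h (by simp [Function.uncurry, h0, kernel_zero_right])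
  exact ⟨(p.1, p.1⁻¹ * p.2), ⟨subset_tsupport _ h1, subset_tsupport _ h2⟩, by simp⟩

theorem hasCompactSupport_section {E : Type*} [Zero E] {F : G → G → E}
    (hF : HasCompactSupport (Function.uncurry F)) (x : G) : HasCompactSupport fun y => F y x := by
  refine HasCompactSupport.intro (hF.image continuous_fst) fun y hy => ?_
  by_contra h
  exact hy ⟨(y, x), subset_tsupport _ h, rfl⟩

variable [MeasurableSpace G] [BorelSpace G] (μ : Measure G)

theorem continuous_integral_of_compact [IsFiniteMeasureOnCompacts μ] {E : Type*}
    [NormedAddCommGroup E] [NormedSpace ℝ E] {F : G → G → E}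
    (hc : Continuous (Function.uncurry F)) (hF : HasCompactSupport (Function.uncurry F)) :
    Continuous (fun x => ∫ y, F y x ∂μ) ∧ HasCompactSupport (fun x => ∫ y, F y x ∂μ) := by
  constructor
  · rw [← continuousOn_univ]
    refine continuousOn_integral_of_compact_support (f := fun x y => F y x)
      (hF.image continuous_fst) ?_ ?_
    · exact (hc.comp continuous_swap).continuousOn
    · intro x y _ hy
      by_contra h
      exact hy ⟨(y, x), subset_tsupport _ h, rfl⟩
  · refine HasCompactSupport.intro (hF.image continuous_snd) fun x hx => ?_
    have : ∀ y, F y x = 0 := fun y => by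
      by_contra h
      exact hx ⟨(y, x), subset_tsupport _ h, rfl⟩
    simp [this]

/-- The twisted convolution `(Φ * Ψ)(x) = ∫ Φ(y) α_y(Ψ(y⁻¹x)) ω(y, y⁻¹x) dy` of two functions. -/
noncomputable def conv (Φ Ψ : G → A) (x : G) : A :=
  ∫ y, T.kernel y x (Φ y) (Ψ (y⁻¹ * x)) ∂μ

/-- The function `x ↦ Δ(x⁻¹) ω(x, x⁻¹)^* α_x(Φ(x⁻¹)^*)`. Mathlib's `modularCharacterFun x` is
`μ(E x⁻¹) / μ(E)`, that is `Δ(x⁻¹)` for the usual convention `μ(E x) = Δ(x) μ(E)`. -/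
noncomputable def starFun [LocallyCompactSpace G] (Φ : G → A) (x : G) : A :=
  modularCharacterFun x •
    (star (T.ω x x⁻¹ : 𝓜(ℂ, A))).fst (T.α x (star (Φ x⁻¹)))

variable [μ.IsHaarMeasure]

theorem integral_integral_norm_le {φ ψ : G → A} (hφ : Continuous φ) (hφ' : HasCompactSupport φ)
    (hψ : Continuous ψ) (hψ' : HasCompactSupport ψ) :
    ∫ x, ∫ y, ‖T.kernel y x (φ y) (ψ (y⁻¹ * x))‖ ∂μ ∂μ ≤
      (∫ y, ‖φ y‖ ∂μ) * ∫ x, ‖ψ x‖ ∂μ := by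
  have hc := T.continuous_integrand hφ hψ
  have hs := T.hasCompactSupport_integrand hφ' hψ'
  have hi : Integrable φ μ := hφ.integrable_of_hasCompactSupport hφ'
  have hj : Integrable ψ μ := hψ.integrable_of_hasCompactSupport hψ'
  rw [← integral_integral_swap_of_hasCompactSupport
    (f := fun y x => ‖T.kernel y x (φ y) (ψ (y⁻¹ * x))‖) hc.norm hs.norm, ← integral_mul_const]
  refine integral_mono_of_nonneg (Eventually.of_forall fun y => integral_nonneg fun x => norm_nonneg _)
    (hi.norm.mul_const _) (Eventually.of_forall fun y => ?_)
  calc ∫ x, ‖T.kernel y x (φ y) (ψ (y⁻¹ * x))‖ ∂μ ≤ ∫ x, ‖φ y‖ * ‖ψ (y⁻¹ * x)‖ ∂μ :=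
        integral_mono_of_nonneg (Eventually.of_forall fun x => norm_nonneg _)
          ((hj.comp_mul_left y⁻¹).norm.const_mul _)
          (Eventually.of_forall fun x => T.norm_kernel_le _ _ _ _)
    _ = ‖φ y‖ * ∫ x, ‖ψ x‖ ∂μ := by
        rw [integral_const_mul, integral_mul_left_eq_self (fun x => ‖ψ x‖) y⁻¹]

variable [LocallyCompactSpace G] [μ.Regular]

theorem conv_congr {Φ Φ' Ψ Ψ' : G → A} (h : Φ =ᵐ[μ] Φ') (h' : Ψ =ᵐ[μ] Ψ') :
    T.conv μ Φ Ψ = T.conv μ Φ' Ψ' := by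
  ext x
  refine integral_congr_ae ?_
  filter_upwards [h, (tendsto_inv_mul_ae μ x).eventually h'] with y h1 h2
  rw [h1, h2]

/-- The twisted convolution of two integrable functions: the defining integral converges
absolutely for almost every `x`, and defines an integrable function. -/
theorem conv_main {Φ Ψ : G → A} (hΦ : Integrable Φ μ) (hΨ : Integrable Ψ μ) :
    (∀ᵐ x ∂μ, Integrable (fun y => T.kernel y x (Φ y) (Ψ (y⁻¹ * x))) μ) ∧
    Integrable (T.conv μ Φ Ψ) μ ∧
    ∫ x, ‖T.conv μ Φ Ψ x‖ ∂μ ≤ (∫ x, ‖Φ x‖ ∂μ) * ∫ x, ‖Ψ x‖ ∂μ := by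
  have key : ∀ ε : ℝ, 0 < ε →
      (∀ᵐ x ∂μ, Integrable (fun y => T.kernel y x (Φ y) (Ψ (y⁻¹ * x))) μ) ∧
      Integrable (T.conv μ Φ Ψ) μ ∧
      ∫ x, ‖T.conv μ Φ Ψ x‖ ∂μ ≤ ((∫ x, ‖Φ x‖ ∂μ) + ε) * ((∫ x, ‖Ψ x‖ ∂μ) + ε) := by
    intro ε hε
    obtain ⟨φ, φc, φs, φsum, φle, φae⟩ := exists_series hΦ hε
    obtain ⟨ψ, ψc, ψs, ψsum, ψle, ψae⟩ := exists_series hΨ hε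
    have φi : ∀ n, Integrable (φ n) μ := fun n => (φc n).integrable_of_hasCompactSupport (φs n)
    have ψi : ∀ n, Integrable (ψ n) μ := fun n => (ψc n).integrable_of_hasCompactSupport (ψs n)
    let F : ℕ × ℕ → G → G → A := fun p y x => T.kernel y x (φ p.1 y) (ψ p.2 (y⁻¹ * x))
    have Fc : ∀ p, Continuous (Function.uncurry (F p)) := fun p =>
      T.continuous_integrand (φc p.1) (ψc p.2)
    have Fs : ∀ p, HasCompactSupport (Function.uncurry (F p)) := fun p =>
      T.hasCompactSupport_integrand (φs p.1) (ψs p.2)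
    have Fi : ∀ p x, Integrable (fun y => F p y x) μ := fun p x =>
      ((Fc p).comp (continuous_id.prodMk continuous_const)).integrable_of_hasCompactSupport
        (hasCompactSupport_section (Fs p) x)
    let g : ℕ × ℕ → G → ℝ := fun p x => ∫ y, ‖F p y x‖ ∂μ
    have g0 : ∀ p x, 0 ≤ g p x := fun p x => integral_nonneg fun y => norm_nonneg _
    have gi : ∀ p, Integrable (g p) μ := fun p => by
      have := continuous_integral_of_compact μ (F := fun y x => ‖F p y x‖) (Fc p).norm (Fs p).norm
      exact this.1.integrable_of_hasCompactSupport this.2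
    have gle : ∀ p, ∫ x, g p x ∂μ ≤ (∫ y, ‖φ p.1 y‖ ∂μ) * ∫ x, ‖ψ p.2 x‖ ∂μ := fun p =>
      T.integral_integral_norm_le μ (φc p.1) (φs p.1) (ψc p.2) (ψs p.2)
    have i0 : ∀ f : G → A, 0 ≤ ∫ y, ‖f y‖ ∂μ := fun f => integral_nonneg fun y => norm_nonneg _
    have psum : Summable fun p : ℕ × ℕ => (∫ y, ‖φ p.1 y‖ ∂μ) * ∫ x, ‖ψ p.2 x‖ ∂μ :=
      φsum.mul_of_nonneg ψsum (fun n => i0 _) (fun n => i0 _)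
    have gsum : Summable fun p => ∫ x, ‖g p x‖ ∂μ := by
      refine Summable.of_nonneg_of_le (fun p => integral_nonneg fun x => norm_nonneg _)
        (fun p => ?_) psum
      simp_rw [Real.norm_of_nonneg (g0 p _)]
      exact gle p
    have hx0 : ∀ᵐ x ∂μ, Summable fun p => g p x := by
      filter_upwards [ae_summable_norm gi gsum] with x hx
      simpa only [Real.norm_of_nonneg (g0 _ _)] using hx
    have hF : ∀ x, ∀ᵐ y ∂μ, HasSum (fun p => F p y x) (T.kernel y x (Φ y) (Ψ (y⁻¹ * x))) := by
      intro x
      filter_upwards [φae, ae_summable_norm φi φsum, (tendsto_inv_mul_ae μ x).eventually ψae,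
        (tendsto_inv_mul_ae μ x).eventually (ae_summable_norm ψi ψsum)] with y h1 h2 h3 h4
      have h5 : Summable fun p : ℕ × ℕ => ‖φ p.1 y‖ * ‖ψ p.2 (y⁻¹ * x)‖ :=
        h2.mul_of_nonneg h4 (fun n => norm_nonneg _) (fun n => norm_nonneg _)
      have h6 : Summable fun p => F p y x :=
        Summable.of_norm_bounded h5 fun p => T.norm_kernel_le _ _ _ _
      have h7 : HasSum (fun n => T.kernel y x (φ n y) (Ψ (y⁻¹ * x)))
          (T.kernel y x (Φ y) (Ψ (y⁻¹ * x))) := (T.kernelLeft y x (Ψ (y⁻¹ * x))).hasSum h1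
      have h8 : ∀ n, HasSum (fun m => F (n, m) y x) (T.kernel y x (φ n y) (Ψ (y⁻¹ * x))) :=
        fun n => (T.kernelRight y x (φ n y)).hasSum h3
      have h9 := h6.hasSum.prod_fiberwise h8
      have h10 := h6.hasSum
      rwa [h9.unique h7] at h10
    have hx1 : ∀ᵐ x ∂μ, Integrable (fun y => T.kernel y x (Φ y) (Ψ (y⁻¹ * x))) μ ∧
        HasSum (fun p => ∫ y, F p y x ∂μ) (T.conv μ Φ Ψ x) := by
      filter_upwards [hx0] with x hx
      have := integrable_of_ae_hasSum (f := fun p y => F p y x) (fun p => Fi p x) hx (hF x)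
      exact ⟨this.1, this.2.1⟩
    have ci : ∀ p, Integrable (fun x => ∫ y, F p y x ∂μ) μ := fun p => by
      have := continuous_integral_of_compact μ (Fc p) (Fs p)
      exact this.1.integrable_of_hasCompactSupport this.2
    have cle : ∀ p, ∫ x, ‖∫ y, F p y x ∂μ‖ ∂μ ≤
        (∫ y, ‖φ p.1 y‖ ∂μ) * ∫ x, ‖ψ p.2 x‖ ∂μ := fun p =>
      (integral_mono (ci p).norm (gi p) fun x => norm_integral_le_integral_norm _).trans (gle p)
    have csum : Summable fun p => ∫ x, ‖∫ y, F p y x ∂μ‖ ∂μ :=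
      Summable.of_nonneg_of_le (fun p => integral_nonneg fun x => norm_nonneg _) cle psum
    have hfin := integrable_of_ae_hasSum ci csum (hx1.mono fun x hx => hx.2)
    refine ⟨hx1.mono fun x hx => hx.1, hfin.1, hfin.2.2.trans ?_⟩
    refine (csum.tsum_le_tsum cle psum).trans ?_
    rw [← φsum.tsum_mul_tsum ψsum psum]
    exact mul_le_mul φle ψle (tsum_nonneg fun n => i0 _) (add_nonneg (i0 _) hε.le)
  refine ⟨(key 1 one_pos).1, (key 1 one_pos).2.1, ?_⟩
  have ht : Tendsto (fun ε : ℝ => ((∫ x, ‖Φ x‖ ∂μ) + ε) * ((∫ x, ‖Ψ x‖ ∂μ) + ε)) (𝓝[>] 0)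
      (𝓝 ((∫ x, ‖Φ x‖ ∂μ) * ∫ x, ‖Ψ x‖ ∂μ)) := by
    refine (Continuous.tendsto' (by fun_prop) 0 _ (by simp)).mono_left nhdsWithin_le_nhds
  exact ge_of_tendsto ht (eventually_nhdsWithin_of_forall fun ε hε => (key ε hε).2.2)

end TwistedAction

namespace TwistedAction

section L1Space
variable {G A : Type*} [Group G] [TopologicalSpace G] [NonUnitalCStarAlgebra A]
  [MeasurableSpace G]

/-- The space `L¹(G, A)` of (classes of) Bochner integrable functions, as the carrier of the
twisted convolution algebra of `T`. -/
def L1 (_T : TwistedAction G A) (μ : Measure G) : Type _ := Lp A 1 μ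

variable (T : TwistedAction G A) (μ : Measure G)

noncomputable instance : NormedAddCommGroup (T.L1 μ) :=
  inferInstanceAs (NormedAddCommGroup (Lp A 1 μ))
noncomputable instance : NormedSpace ℂ (T.L1 μ) := inferInstanceAs (NormedSpace ℂ (Lp A 1 μ))
instance : CompleteSpace (T.L1 μ) := inferInstanceAs (CompleteSpace (Lp A 1 μ))

variable {T μ} in
/-- A representative of a class in `L¹(G, A)`. -/
noncomputable def L1.toFun (Φ : T.L1 μ) : G → A := ((show Lp A 1 μ from Φ) : G → A)

noncomputable instance : CoeFun (T.L1 μ) (fun _ => G → A) := ⟨L1.toFun⟩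

/-- The class in `L¹(G, A)` of an integrable function. -/
noncomputable def mkL1 (f : G → A) (hf : Integrable f μ) : T.L1 μ := hf.toL1 f

theorem coeFn_mkL1 {f : G → A} (hf : Integrable f μ) : ⇑(T.mkL1 μ f hf) =ᵐ[μ] f :=
  hf.coeFn_toL1

namespace L1
variable {T μ}
theorem integrable (Φ : T.L1 μ) : Integrable (⇑Φ) μ :=
  MeasureTheory.L1.integrable_coeFn (show Lp A 1 μ from Φ)
theorem ext' {Φ Ψ : T.L1 μ} (h : Φ =ᵐ[μ] Ψ) : Φ = Ψ := Lp.ext h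
theorem coeFn_add (Φ Ψ : T.L1 μ) : ⇑(Φ + Ψ) =ᵐ[μ] ⇑Φ + ⇑Ψ := Lp.coeFn_add _ _
theorem coeFn_sub (Φ Ψ : T.L1 μ) : ⇑(Φ - Ψ) =ᵐ[μ] ⇑Φ - ⇑Ψ := Lp.coeFn_sub _ _
theorem coeFn_smul (c : ℂ) (Φ : T.L1 μ) : ⇑(c • Φ) =ᵐ[μ] c • ⇑Φ := Lp.coeFn_smul _ _
theorem norm_eq (Φ : T.L1 μ) : ‖Φ‖ = ∫ x, ‖Φ x‖ ∂μ := MeasureTheory.L1.norm_eq_integral_norm _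
end L1
end L1Space

variable {G A : Type*} [Group G] [TopologicalSpace G] [IsTopologicalGroup G]
  [NonUnitalCStarAlgebra A] (T : TwistedAction G A) [MeasurableSpace G] [BorelSpace G]
  (μ : Measure G) [μ.IsHaarMeasure]

theorem conv_assoc_of_compact {φ ψ χ : G → A}
    (hφ : Continuous φ) (hφ' : HasCompactSupport φ) (hψ : Continuous ψ)
    (hψ' : HasCompactSupport ψ) (hχ : Continuous χ) (hχ' : HasCompactSupport χ) (x : G) :
    T.conv μ (T.conv μ φ ψ) χ x = T.conv μ φ (T.conv μ ψ χ) x := by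
  have c1 := T.continuous_integrand hφ hψ
  have s1 := T.hasCompactSupport_integrand hφ' hψ'
  have c2 := T.continuous_integrand hψ hχ
  have s2 := T.hasCompactSupport_integrand hψ' hχ'
  let F : G → G → A := fun z y => T.kernel z x (T.kernel y z (φ y) (ψ (y⁻¹ * z))) (χ (z⁻¹ * x))
  have Fc : Continuous (Function.uncurry F) := by
    have h1 : Continuous fun p : G × G => T.kernel p.2 p.1 (φ p.2) (ψ (p.2⁻¹ * p.1)) :=
      c1.comp continuous_swap
    exact T.continuous_kernel.comp
      (f := fun p : G × G => ((p.1, x), (T.kernel p.2 p.1 (φ p.2) (ψ (p.2⁻¹ * p.1)),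
        χ (p.1⁻¹ * x)))) (by fun_prop)
  have Fs : HasCompactSupport (Function.uncurry F) := by
    have hK : IsCompact (Prod.swap '' tsupport
        (Function.uncurry fun y z : G => T.kernel y z (φ y) (ψ (y⁻¹ * z)))) :=
      IsCompact.image s1 continuous_swap
    refine HasCompactSupport.intro hK fun p hp => ?_
    by_contra h
    refine hp ⟨(p.2, p.1), subset_tsupport _ fun h0 => h ?_, rfl⟩
    simp only [Function.uncurry] at h0
    simp [Function.uncurry, F, h0, kernel_zero_left]
  have e1 : T.conv μ (T.conv μ φ ψ) χ x = ∫ z, ∫ y, F z y ∂μ ∂μ := by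
    refine integral_congr_ae (Eventually.of_forall fun z => ?_)
    have hi : Integrable (fun y => T.kernel y z (φ y) (ψ (y⁻¹ * z))) μ :=
      (c1.comp (continuous_id.prodMk continuous_const)).integrable_of_hasCompactSupport
        (hasCompactSupport_section s1 z)
    exact ((T.kernelLeft z x (χ (z⁻¹ * x))).integral_comp_comm hi).symm
  rw [e1, integral_integral_swap_of_hasCompactSupport Fc Fs]
  refine integral_congr_ae (Eventually.of_forall fun y => ?_)
  have hi : Integrable (fun z => T.kernel z (y⁻¹ * x) (ψ z) (χ (z⁻¹ * (y⁻¹ * x)))) μ :=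
    (c2.comp (continuous_id.prodMk continuous_const)).integrable_of_hasCompactSupport
      (hasCompactSupport_section s2 (y⁻¹ * x))
  have e2 : T.kernel y x (φ y) (T.conv μ ψ χ (y⁻¹ * x)) =
      ∫ z, T.kernel y x (φ y) (T.kernel z (y⁻¹ * x) (ψ z) (χ (z⁻¹ * (y⁻¹ * x)))) ∂μ :=
    ((T.kernelRight y x (φ y)).integral_comp_comm hi).symm
  simp only
  rw [e2, ← integral_mul_left_eq_self (fun z => F z y) y]
  refine integral_congr_ae (Eventually.of_forall fun z => ?_)
  have h := T.kernel_assoc y z (z⁻¹ * (y⁻¹ * x)) (φ y) (ψ z) (χ (z⁻¹ * (y⁻¹ * x)))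
  have g1 : y * (z * (z⁻¹ * (y⁻¹ * x))) = x := by group
  have g2 : z * (z⁻¹ * (y⁻¹ * x)) = y⁻¹ * x := by group
  have g3 : y * z * (z⁻¹ * (y⁻¹ * x)) = x := by group
  rw [g1, g2, g3] at h
  have g4 : (y * z)⁻¹ * x = z⁻¹ * (y⁻¹ * x) := by group
  simp only [F, inv_mul_cancel_left, g4]
  exact h.symm

variable [LocallyCompactSpace G] [μ.Regular]

theorem aestronglyMeasurable_fiberwise {h : G → A → A}
    (hc : Continuous fun p : G × A => h p.1 p.2) (hz : ∀ x, h x 0 = 0) {f : G → A}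
    (hf : Integrable f μ) : AEStronglyMeasurable (fun x => h x (f x)) μ := by
  obtain ⟨φ, φc, φs, -, -, φae⟩ := exists_series hf one_pos
  have hcn : ∀ n : ℕ, Continuous fun x => ∑ i ∈ Finset.range n, φ i x := fun n =>
    continuous_finsetSum _ fun i _ => φc i
  have hsn : ∀ n : ℕ, HasCompactSupport fun x => ∑ i ∈ Finset.range n, φ i x := by
    intro n
    induction n with
    | zero =>
      simp only [Finset.range_zero, Finset.sum_empty]
      exact HasCompactSupport.zero
    | succ n ih =>
      simp_rw [Finset.sum_range_succ]
      exact ih.add (φs n)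
  refine aestronglyMeasurable_of_tendsto_ae atTop
    (f := fun (n : ℕ) x => h x (∑ i ∈ Finset.range n, φ i x)) (fun n => ?_) ?_
  · have h2 : Continuous fun x => h x (∑ i ∈ Finset.range n, φ i x) :=
      hc.comp (continuous_id.prodMk (hcn n))
    refine (h2.integrable_of_hasCompactSupport (HasCompactSupport.intro (hsn n) fun x hx => ?_)).1
    rw [image_eq_zero_of_notMem_tsupport hx, hz]
  · filter_upwards [φae] with x hx
    have t : Tendsto (fun n : ℕ => (x, ∑ i ∈ Finset.range n, φ i x)) atTop (𝓝 (x, f x)) :=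
      tendsto_const_nhds.prodMk_nhds hx.tendsto_sum_nat
    exact (hc.tendsto (x, f x)).comp t

theorem integrable_starFun {Φ : G → A} (hΦ : Integrable Φ μ) : Integrable (T.starFun Φ) μ := by
  have hf := integrable_modular_smul_inv μ hΦ
  let h : G → A → A := fun x a => (star (T.ω x x⁻¹ : 𝓜(ℂ, A))).fst (T.α x (star a))
  have hn : ∀ x a, ‖h x a‖ ≤ ‖a‖ := fun x a => by
    refine (norm_fst_le (star (T.ω x x⁻¹)) _).trans ?_
    rw [StarAlgEquiv.norm_map, norm_star]
  have hc : Continuous fun p : G × A => h p.1 p.2 := by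
    have h1 : Continuous fun p : G × A => star (T.α p.1 (star p.2)) :=
      (T.continuous_α_prod.comp (f := fun p : G × A => (p.1, star p.2)) (by fun_prop)).star
    have h2 := T.continuous_ω_right_prod.comp
      (f := fun p : G × A => ((p.1, p.1⁻¹), star (T.α p.1 (star p.2)))) (by fun_prop)
    simp only [h, DoubleCentralizer.star_fst]
    exact h2.star
  have hz : ∀ x, h x 0 = 0 := fun x => by simp [h]
  have hs : T.starFun Φ = fun x => h x (modularCharacterFun x • Φ x⁻¹) := by
    ext x
    simp only [starFun, h, NNReal.smul_def, ← Complex.coe_smul, star_smul, map_smul]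
    simp
  rw [hs]
  have hm := aestronglyMeasurable_fiberwise μ hc hz hf
  exact hf.mono hm (Eventually.of_forall fun x => hn x _)

/-- The product of the twisted convolution algebra. -/
noncomputable instance : Mul (T.L1 μ) :=
  ⟨fun Φ Ψ => T.mkL1 μ (T.conv μ Φ Ψ) (T.conv_main μ Φ.integrable Ψ.integrable).2.1⟩

/-- The involution of the twisted convolution algebra. -/
noncomputable instance : Star (T.L1 μ) :=
  ⟨fun Φ => T.mkL1 μ (T.starFun Φ) (T.integrable_starFun μ Φ.integrable)⟩

namespace L1
variable {T μ}

theorem coeFn_mul (Φ Ψ : T.L1 μ) : ⇑(Φ * Ψ) =ᵐ[μ] T.conv μ Φ Ψ := T.coeFn_mkL1 μ _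
theorem coeFn_star (Φ : T.L1 μ) : ⇑(star Φ) =ᵐ[μ] T.starFun Φ := T.coeFn_mkL1 μ _

protected theorem add_mul (Φ Φ' Ψ : T.L1 μ) : (Φ + Φ') * Ψ = Φ * Ψ + Φ' * Ψ := by
  refine ext' ((coeFn_mul _ _).trans ?_)
  rw [T.conv_congr μ (coeFn_add Φ Φ') (ae_eq_refl _)]
  filter_upwards [coeFn_add (Φ * Ψ) (Φ' * Ψ), coeFn_mul Φ Ψ, coeFn_mul Φ' Ψ,
    (T.conv_main μ Φ.integrable Ψ.integrable).1, (T.conv_main μ Φ'.integrable Ψ.integrable).1]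
    with x h1 h2 h3 h4 h5
  rw [h1, Pi.add_apply, h2, h3]
  simp only [conv, Pi.add_apply, kernel_add_left]
  exact integral_add h4 h5

protected theorem mul_add (Φ Ψ Ψ' : T.L1 μ) : Φ * (Ψ + Ψ') = Φ * Ψ + Φ * Ψ' := by
  refine ext' ((coeFn_mul _ _).trans ?_)
  rw [T.conv_congr μ (ae_eq_refl _) (coeFn_add Ψ Ψ')]
  filter_upwards [coeFn_add (Φ * Ψ) (Φ * Ψ'), coeFn_mul Φ Ψ, coeFn_mul Φ Ψ',
    (T.conv_main μ Φ.integrable Ψ.integrable).1, (T.conv_main μ Φ.integrable Ψ'.integrable).1]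
    with x h1 h2 h3 h4 h5
  rw [h1, Pi.add_apply, h2, h3]
  simp only [conv, Pi.add_apply, kernel_add_right]
  exact integral_add h4 h5

protected theorem smul_mul (c : ℂ) (Φ Ψ : T.L1 μ) : (c • Φ) * Ψ = c • (Φ * Ψ) := by
  refine ext' ((coeFn_mul _ _).trans ?_)
  rw [T.conv_congr μ (coeFn_smul c Φ) (ae_eq_refl _)]
  filter_upwards [coeFn_smul c (Φ * Ψ), coeFn_mul Φ Ψ] with x h1 h2
  rw [h1, Pi.smul_apply, h2]
  simp only [conv, Pi.smul_apply, kernel_smul_left]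
  exact integral_smul _ _

protected theorem mul_smul (c : ℂ) (Φ Ψ : T.L1 μ) : Φ * (c • Ψ) = c • (Φ * Ψ) := by
  refine ext' ((coeFn_mul _ _).trans ?_)
  rw [T.conv_congr μ (ae_eq_refl _) (coeFn_smul c Ψ)]
  filter_upwards [coeFn_smul c (Φ * Ψ), coeFn_mul Φ Ψ] with x h1 h2
  rw [h1, Pi.smul_apply, h2]
  simp only [conv, Pi.smul_apply, kernel_smul_right]
  exact integral_smul _ _

protected theorem norm_mul_le (Φ Ψ : T.L1 μ) : ‖Φ * Ψ‖ ≤ ‖Φ‖ * ‖Ψ‖ := by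
  rw [norm_eq, norm_eq, norm_eq]
  refine le_trans (le_of_eq ?_) (T.conv_main μ Φ.integrable Ψ.integrable).2.2
  exact integral_congr_ae ((coeFn_mul Φ Ψ).mono fun x hx => by simp only [hx])

/-- The product of `L¹(G, A)` as a bounded bilinear map. -/
noncomputable def mulL : T.L1 μ →L[ℂ] T.L1 μ →L[ℂ] T.L1 μ :=
  LinearMap.mkContinuous₂
    (LinearMap.mk₂ ℂ (fun Φ Ψ : T.L1 μ => Φ * Ψ) L1.add_mul L1.smul_mul L1.mul_add
      (fun c Φ Ψ => L1.mul_smul c Φ Ψ)) 1 (fun Φ Ψ => by simpa using L1.norm_mul_le Φ Ψ)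

theorem mulL_apply (Φ Ψ : T.L1 μ) : mulL Φ Ψ = Φ * Ψ := rfl

/-- To check a closed condition on `L¹(G, A)`, it suffices to check it on the classes of
continuous compactly supported functions. -/
theorem induction_compact {P : T.L1 μ → Prop} (hP : IsClosed {Φ | P Φ})
    (h : ∀ (φ : G → A) (_ : Continuous φ) (_ : HasCompactSupport φ) (Φ : T.L1 μ),
      Φ =ᵐ[μ] φ → P Φ) (Φ : T.L1 μ) : P Φ := by
  have : Φ ∈ closure {Φ | P Φ} := by
    refine Metric.mem_closure_iff.2 fun δ hδ => ?_
    obtain ⟨g, g1, g2, g3, g4⟩ := exists_hasCompactSupport_near Φ.integrable (half_pos hδ)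
    refine ⟨T.mkL1 μ g g3, h g g1 g2 _ (T.coeFn_mkL1 μ g3), ?_⟩
    rw [dist_eq_norm, norm_eq]
    have : ∫ x, ‖(Φ - T.mkL1 μ g g3) x‖ ∂μ = ∫ x, ‖Φ x - g x‖ ∂μ := by
      refine integral_congr_ae ?_
      filter_upwards [coeFn_sub Φ (T.mkL1 μ g g3), T.coeFn_mkL1 μ g3] with x h1 h2
      rw [h1, Pi.sub_apply, h2]
    linarith
  rwa [hP.closure_eq] at this

protected theorem mul_assoc (Φ Ψ X : T.L1 μ) : Φ * Ψ * X = Φ * (Ψ * X) := by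
  simp only [← mulL_apply]
  refine induction_compact (P := fun Φ => mulL (mulL Φ Ψ) X = mulL Φ (mulL Ψ X))
    (isClosed_eq (by fun_prop) (by fun_prop)) (fun φ φ1 φ2 Φ hΦ => ?_) Φ
  refine induction_compact (P := fun Ψ => mulL (mulL Φ Ψ) X = mulL Φ (mulL Ψ X))
    (isClosed_eq (by fun_prop) (by fun_prop)) (fun ψ ψ1 ψ2 Ψ hΨ => ?_) Ψ
  refine induction_compact (P := fun X => mulL (mulL Φ Ψ) X = mulL Φ (mulL Ψ X))
    (isClosed_eq (by fun_prop) (by fun_prop)) (fun χ χ1 χ2 X hX => ?_) X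
  simp only [mulL_apply]
  refine ext' ((coeFn_mul _ _).trans (EventuallyEq.trans ?_ (coeFn_mul _ _).symm))
  have h1 : ⇑(Φ * Ψ) =ᵐ[μ] T.conv μ φ ψ := by
    rw [← T.conv_congr μ hΦ hΨ]; exact coeFn_mul Φ Ψ
  have h2 : ⇑(Ψ * X) =ᵐ[μ] T.conv μ ψ χ := by
    rw [← T.conv_congr μ hΨ hX]; exact coeFn_mul Ψ X
  rw [T.conv_congr μ h1 hX, T.conv_congr μ hΦ h2]
  exact Eventually.of_forall fun x => T.conv_assoc_of_compact μ φ1 φ2 ψ1 ψ2 χ1 χ2 x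

end L1

/-- `L¹(G, A)` with the twisted convolution is a Banach algebra. -/
noncomputable instance : NonUnitalNormedRing (T.L1 μ) :=
  { (inferInstance : NormedAddCommGroup (T.L1 μ)) with
    mul := (· * ·)
    left_distrib := L1.mul_add
    right_distrib := L1.add_mul
    zero_mul := fun Φ => by simp only [← L1.mulL_apply, map_zero, zero_apply]
    mul_zero := fun Φ => by simp only [← L1.mulL_apply, map_zero]
    mul_assoc := L1.mul_assoc
    norm_mul_le := L1.norm_mul_le }

instance : IsScalarTower ℂ (T.L1 μ) (T.L1 μ) := ⟨fun c Φ Ψ => L1.smul_mul c Φ Ψ⟩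
instance : SMulCommClass ℂ (T.L1 μ) (T.L1 μ) := ⟨fun c Φ Ψ => (L1.mul_smul c Φ Ψ).symm⟩

end TwistedAction

namespace TwistedConvolution

/-- A linear subspace of a (not necessarily unital) complex algebra that is a two-sided ideal. -/
def IsTwoSidedIdeal {B : Type*} [NonUnitalRing B] [Module ℂ B] (I : Submodule ℂ B) : Prop :=
  ∀ b : B, ∀ x ∈ I, b * x ∈ I ∧ x * b ∈ I

/-- The quotient ring `B / I` by a two-sided ideal `I`. -/
abbrev QuotientRing {B : Type*} [NonUnitalRing B] [Module ℂ B] {I : Submodule ℂ B}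
    (hI : IsTwoSidedIdeal I) : Type _ :=
  (TwoSidedIdeal.mk' (I : Set B) I.zero_mem (fun h h' => I.add_mem h h') (fun h => I.neg_mem h)
    (fun {x y} h => (hI x y h).1) (fun {x y} h => (hI y x h).2)).ringCon.Quotient

/-- The Jacobson radical of a (not necessarily unital) ring `R`: the set of all `a` such that
every element of `R a` is quasi-invertible. (`IsQuasiregular x` says that `1 + x` is invertible
in the unitization.) -/
def jacobsonRadical (R : Type*) [NonUnitalRing R] : Set R := {a | ∀ b : R, IsQuasiregular (b * a)}

/-- A (not necessarily unital) ring is semisimple if its Jacobson radical is zero. -/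
def IsSemisimple (R : Type*) [NonUnitalRing R] : Prop := jacobsonRadical R = {0}

end TwistedConvolution

end

universe u v

/-! Write `V` for the quotient of `L¹(G, A)` by `I`, with its quotient norm. Two families of
operators act on `L¹(G, A)` from the left: multipliers of `A` (`lam`) and twisted translations `U_g`
(`transl`). Unitary multipliers and translations are contractions, with contractive inverses up to a
unitary multiplier, hence isometries. A closed left ideal is invariant under both families, because
`a U_g Ψ` is a limit of products `E * Ψ` with `E` concentrated near `g` (`exists_mul_near`,
`lam_mem`, `transl_mem`). Both families therefore descend to `V`, and the isometric operators stay
isometric.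

Since `V` is finite-dimensional, its group of linear isometries is compact; averaging an inner
product over it makes `V` a Hilbert space on which all norm-preserving linear maps are unitary
(`exists_invariant_euclidean`). Left multiplication by `Φ` is the integrated form `∫ ρ(Φ(y)) W_y dy`
of these operators (`mul_eq_integral`), and the involution of `L¹(G, A)` is exactly what corresponds
to the adjoint of such an integral when `ρ` preserves adjoints and the `W_y` are unitary
(`rep_star`). Left multiplication on `V` is thus a *-representation `π`.

Its kernel consists of the `Φ` with `Φ * E ∈ I` for all `E`. It contains `I` since `I` is a right
ideal, and it is contained in `I` by right approximate units (`exists_mul_right_near`). So `I` is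
the kernel of a *-homomorphism into a matrix algebra (`exists_rep`): it is *-closed, the quotient is
the range of `π`, a finite-dimensional C*-algebra, and an element of the radical is zero because a
nonzero `π(Φ)^* π(Φ)` has a nonzero spectral value. -/

section

open MeasureTheory Measure Topology Filter
open scoped NNReal ENNReal InnerProductSpace

namespace TwistedConvolution

/-! ### Invariant inner products on finite-dimensional normed spaces. -/

section InvariantInnerProduct

/-- The group of invertible isometric operators on a normed space. -/
def isometryUnits (V : Type*) [NormedAddCommGroup V] [NormedSpace ℂ V] :
    Subgroup (V →L[ℂ] V)ˣ where
  carrier := {u | ∀ v, ‖(u : V →L[ℂ] V) v‖ = ‖v‖}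
  one_mem' v := rfl
  mul_mem' {a b} ha hb v := by
    have := (ha ((b : V →L[ℂ] V) v)).trans (hb v)
    simpa using this
  inv_mem' {a} ha v := by
    have h := ha ((↑a⁻¹ : V →L[ℂ] V) v)
    have h2 : (a : V →L[ℂ] V) ((↑a⁻¹ : V →L[ℂ] V) v) = v :=
      congrArg (fun f : V →L[ℂ] V => f v) a.mul_inv
    rw [h2] at h
    exact h.symm

/-- The closed embedding `u ↦ (u, op u⁻¹)` of the unit group sends isometries into a product of two
unit balls, which is compact since operators on `V` form a proper space; being isometric is a closed
condition. -/
theorem compactSpace_isometryUnits (V : Type*) [NormedAddCommGroup V] [NormedSpace ℂ V]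
    [FiniteDimensional ℂ V] : CompactSpace (isometryUnits V) := by
  have : ProperSpace (V →L[ℂ] V) := FiniteDimensional.proper ℂ _
  suffices IsCompact (isometryUnits V : Set (V →L[ℂ] V)ˣ) from isCompact_iff_compactSpace.1 this
  have hK : IsCompact (Metric.closedBall (0 : V →L[ℂ] V) 1 ×ˢ
      (MulOpposite.op '' Metric.closedBall (0 : V →L[ℂ] V) 1)) :=
    (isCompact_closedBall _ _).prod
      ((isCompact_closedBall _ _).image MulOpposite.continuous_op)
  have hc := (Units.isClosedEmbedding_embedProduct (α := V →L[ℂ] V)).isCompact_preimage hK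
  refine hc.of_isClosed_subset ?_ ?_
  · have : ((isometryUnits V : Subgroup _) : Set (V →L[ℂ] V)ˣ) =
        ⋂ v : V, {u : (V →L[ℂ] V)ˣ | ‖(u : V →L[ℂ] V) v‖ = ‖v‖} := by
      ext u
      rw [Set.mem_iInter]
      rfl
    rw [this]
    refine isClosed_iInter fun v => isClosed_eq ?_ continuous_const
    have h1 : Continuous fun u : (V →L[ℂ] V)ˣ => (u : V →L[ℂ] V) v :=
      (ContinuousLinearMap.apply ℂ V v).continuous.comp Units.continuous_val
    exact h1.norm
  · intro u hu
    have h1 : ∀ w : (V →L[ℂ] V)ˣ, w ∈ isometryUnits V → ‖(w : V →L[ℂ] V)‖ ≤ 1 := fun w hw =>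
      ContinuousLinearMap.opNorm_le_bound _ zero_le_one fun v => by rw [one_mul]; exact (hw v).le
    refine ⟨by simpa using h1 u hu, ⟨_, by simpa using h1 _ (inv_mem hu), rfl⟩⟩

/-- Coordinates in an orthonormal basis. The `ULift` only places the coordinate space in a
prescribed universe, which the final C*-algebra inherits. -/
theorem exists_equiv_of_core {V : Type*} [AddCommGroup V] [Module ℂ V] [FiniteDimensional ℂ V]
    (c : InnerProductSpace.Core ℂ V) :
    ∃ (n : ℕ) (e : V ≃ₗ[ℂ] EuclideanSpace ℂ (ULift.{w} (Fin n))),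
      ∀ v, ‖e v‖ = √(RCLike.re (c.inner v v)) := by
  let _ : NormedAddCommGroup V := c.toNormedAddCommGroup
  let _ : InnerProductSpace ℂ V := InnerProductSpace.ofCore c.toCore
  refine ⟨Module.finrank ℂ V,
    ((stdOrthonormalBasis ℂ V).reindex Equiv.ulift.symm).repr.toLinearEquiv, fun v => ?_⟩
  exact (LinearIsometryEquiv.norm_map _ v).trans rfl

/-- A finite-dimensional normed space carries an inner product that is invariant under all
norm-preserving linear maps. -/
theorem exists_invariant_euclidean (V : Type*) [NormedAddCommGroup V] [NormedSpace ℂ V]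
    [FiniteDimensional ℂ V] :
    ∃ (n : ℕ) (e : V ≃ₗ[ℂ] EuclideanSpace ℂ (ULift.{w} (Fin n))),
      ∀ k : V →ₗ[ℂ] V, (∀ v, ‖k v‖ = ‖v‖) → ∀ v, ‖e (k v)‖ = ‖e v‖ := by
  let Γ := isometryUnits V
  have : CompactSpace Γ := compactSpace_isometryUnits V
  let _ : MeasurableSpace Γ := borel Γ
  have : BorelSpace Γ := ⟨rfl⟩
  let ν : Measure Γ := haar
  let n := Module.finrank ℂ V
  let e₀ : V ≃L[ℂ] EuclideanSpace ℂ (Fin n) :=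
    ContinuousLinearEquiv.ofFinrankEq (by simp [n])
  -- The inverse of `k` is applied so that replacing `v` by `g v` becomes the left translation `k ↦
  -- g⁻¹ k`, under which the Haar measure is invariant.
  let a : Γ → V → EuclideanSpace ℂ (Fin n) := fun k v =>
    e₀ ((((k⁻¹ : Γ) : (V →L[ℂ] V)ˣ) : V →L[ℂ] V) v)
  have ac : ∀ v, Continuous fun k => a k v := fun v => by
    have h1 : Continuous fun k : Γ => (((k⁻¹ : Γ) : (V →L[ℂ] V)ˣ) : V →L[ℂ] V) :=
      Units.continuous_val.comp (continuous_subtype_val.comp continuous_inv)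
    exact e₀.continuous.comp ((ContinuousLinearMap.apply ℂ V v).continuous.comp h1)
  have cont : ∀ v w, Continuous fun k => ⟪a k v, a k w⟫_ℂ := fun v w => (ac v).inner (ac w)
  have int : ∀ v w, Integrable (fun k => ⟪a k v, a k w⟫_ℂ) ν := fun v w =>
    (cont v w).integrable_of_hasCompactSupport (HasCompactSupport.of_compactSpace _)
  have re_eq : ∀ v, RCLike.re (∫ k, ⟪a k v, a k v⟫_ℂ ∂ν) = ∫ k, ‖a k v‖ ^ 2 ∂ν := fun v => by
    rw [← integral_re (int v v)]
    exact integral_congr_ae (Eventually.of_forall fun k => inner_self_eq_norm_sq _)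
  let c : InnerProductSpace.Core ℂ V :=
    { inner := fun v w => ∫ k, ⟪a k v, a k w⟫_ℂ ∂ν
      conj_inner_symm := fun v w => by
        rw [← integral_conj]
        exact integral_congr_ae (Eventually.of_forall fun k => inner_conj_symm _ _)
      re_inner_nonneg := fun v => by
        rw [re_eq]
        exact integral_nonneg fun k => sq_nonneg _
      add_left := fun x y z => by
        rw [← integral_add (int x z) (int y z)]
        refine integral_congr_ae (Eventually.of_forall fun k => ?_)
        simp only [a, map_add, inner_add_left]
      smul_left := fun x y r => by
        rw [← integral_const_mul]
        refine integral_congr_ae (Eventually.of_forall fun k => ?_)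
        simp only [a, map_smul, inner_smul_left]
      definite := fun v hv => by
        by_contra h0
        -- The integrand is continuous, nonnegative, and nonzero at the identity, where it is the
        -- squared norm of `e₀ v`.
        have h1 : 0 < ∫ k, ‖a k v‖ ^ 2 ∂ν := by
          refine ((ac v).norm.pow 2).integral_pos_of_hasCompactSupport_nonneg_nonzero
            (HasCompactSupport.of_compactSpace _) (fun k => sq_nonneg _) (x := 1) ?_
          simpa [a] using h0
        rw [← re_eq, hv] at h1
        simp at h1 }
  obtain ⟨m, e, he⟩ := exists_equiv_of_core c
  refine ⟨m, e, fun k hk v => ?_⟩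
  rw [he, he]
  congr 2
  -- A norm-preserving map is injective, hence invertible in finite dimension, and so defines an
  -- element of `Γ`.
  let kc : V ≃L[ℂ] V := (LinearEquiv.ofInjectiveEndo k (by
    rw [← LinearMap.ker_eq_bot, LinearMap.ker_eq_bot']
    intro v hv
    rw [← norm_eq_zero, ← hk, hv, norm_zero])).toContinuousLinearEquiv
  let g : Γ := ⟨ContinuousLinearEquiv.unitsEquiv ℂ V |>.symm kc, fun v => hk v⟩
  have hg : ∀ h : Γ, a h (k v) = a (g⁻¹ * h) v := fun h => by
    simp only [a, mul_inv_rev, inv_inv]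
    rfl
  change ∫ h, ⟪a h (k v), a h (k v)⟫_ℂ ∂ν = ∫ h, ⟪a h v, a h v⟫_ℂ ∂ν
  simp_rw [hg]
  exact integral_mul_left_eq_self (fun h => ⟪a h v, a h v⟫_ℂ) g⁻¹

end InvariantInnerProduct

/-! ### Approximate units of a C*-algebra on compact sets. -/

section ApproximateUnit
variable {A : Type*} [NonUnitalCStarAlgebra A]

/-- A C*-algebra has contractive approximate units that are uniform on compact sets. -/
theorem exists_approximateUnit_of_isCompact {S : Set A} (hS : IsCompact S) {ε : ℝ} (hε : 0 < ε) :
    ∃ a : A, ‖a‖ ≤ 1 ∧ ∀ b ∈ S, ‖a * b - b‖ ≤ ε ∧ ‖b * a - b‖ ≤ ε := by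
  -- The canonical approximate unit is indexed by an order, installed here only locally.
  let _ := CStarAlgebra.spectralOrder A
  have := CStarAlgebra.spectralOrderedRing A
  have hl := CStarAlgebra.increasingApproximateUnit A
  -- A finite `ε / 3`-net suffices: contractivity of `a` controls the passage from the net to all of
  -- `S`.
  obtain ⟨t, -, tf, ht⟩ := hS.finite_cover_balls (show 0 < ε / 3 by positivity)
  have h1 : ∀ᶠ a in CStarAlgebra.approximateUnit A, ∀ c ∈ t,
      ‖a * c - c‖ < ε / 3 ∧ ‖c * a - c‖ < ε / 3 := by
    rw [Filter.eventually_all_finite tf]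
    intro c _
    have e1 := (hl.tendsto_mul_right c).eventually (Metric.ball_mem_nhds c (show 0 < ε / 3 by positivity))
    have e2 := (hl.tendsto_mul_left c).eventually (Metric.ball_mem_nhds c (show 0 < ε / 3 by positivity))
    filter_upwards [e1, e2] with a h1 h2
    rw [dist_eq_norm] at h1 h2
    exact ⟨h1, h2⟩
  have := hl.neBot
  obtain ⟨a, ha, ha1⟩ := (h1.and hl.eventually_norm).exists
  refine ⟨a, ha1, fun b hb => ?_⟩
  obtain ⟨c, hc, hbc⟩ := Set.mem_iUnion₂.1 (ht hb)
  rw [mem_ball_iff_norm] at hbc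
  obtain ⟨h2, h3⟩ := ha c hc
  constructor
  · have : a * b - b = a * (b - c) + (a * c - c) - (b - c) := by rw [mul_sub]; abel
    rw [this]
    have h4 : ‖a * (b - c)‖ ≤ ‖b - c‖ :=
      (norm_mul_le _ _).trans (mul_le_of_le_one_left (norm_nonneg _) ha1)
    have h5 := norm_sub_le (a * (b - c) + (a * c - c)) (b - c)
    have h6 := norm_add_le (a * (b - c)) (a * c - c)
    linarith
  · have : b * a - b = (b - c) * a + (c * a - c) - (b - c) := by rw [sub_mul]; abel
    rw [this]
    have h4 : ‖(b - c) * a‖ ≤ ‖b - c‖ :=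
      (norm_mul_le _ _).trans (mul_le_of_le_one_right (norm_nonneg _) ha1)
    have h5 := norm_sub_le ((b - c) * a + (c * a - c)) (b - c)
    have h6 := norm_add_le ((b - c) * a) (c * a - c)
    linarith

end ApproximateUnit

/-! ### Haar measure: inversion and averaging near a point. -/

section Haar
variable {G : Type*} [Group G] [TopologicalSpace G] [IsTopologicalGroup G] [LocallyCompactSpace G]
  [MeasurableSpace G] [BorelSpace G] (μ : Measure G) [μ.IsHaarMeasure] [μ.Regular]

/-- The change of variable `x ↦ x⁻¹` for a left Haar measure. -/
theorem integral_modular_smul_inv {E : Type*} [NormedAddCommGroup E] [NormedSpace ℝ E]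
    [CompleteSpace E]
    {f : G → E} (hf : Continuous f) (hf' : HasCompactSupport f) :
    ∫ x, modularCharacterFun x • f x⁻¹ ∂μ = ∫ x, f x ∂μ := by
  obtain ⟨⟨g, gc⟩, gs, g0, g1⟩ :
    ∃ g : C(G, ℝ), HasCompactSupport g ∧ 0 ≤ g ∧ g 1 ≠ 0 := exists_continuous_nonneg_pos 1
  simp only [ContinuousMap.coe_mk] at gs g1
  have hI : ∫ x, g x ∂μ ≠ 0 :=
    ne_of_gt (gc.integral_pos_of_hasCompactSupport_nonneg_nonzero gs g0 g1)
  have mc : Continuous (modularCharacterFun : G → ℝ≥0) := continuous_modularCharacterFun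
  have mi : ∀ x : G, modularCharacterFun x * modularCharacterFun x⁻¹ = 1 := fun x => by
    rw [← modularCharacterFun_map_mul, mul_inv_cancel, modularCharacterFun_map_one]
  have c1 : Continuous (Function.uncurry fun y x : G =>
      g y • modularCharacterFun (y⁻¹ * x) • f (x⁻¹ * y)) := by
    have := mc.comp (f := fun p : G × G => p.1⁻¹ * p.2) (by fun_prop)
    simp only [Function.uncurry_def]
    exact (gc.comp continuous_fst).smul (this.smul (hf.comp (by fun_prop)))
  have s1 : HasCompactSupport (Function.uncurry fun y x : G =>
      g y • modularCharacterFun (y⁻¹ * x) • f (x⁻¹ * y)) := by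
    have hK : IsCompact ((fun p : G × G => (p.1, p.1 * p.2⁻¹)) '' (tsupport g ×ˢ tsupport f)) :=
      (IsCompact.prod gs hf').image (by fun_prop)
    refine HasCompactSupport.intro hK fun p hp => ?_
    by_contra h
    have h1 : g p.1 ≠ 0 := fun h0 => h (by simp [Function.uncurry, h0])
    have h2 : f (p.2⁻¹ * p.1) ≠ 0 := fun h0 => h (by simp [Function.uncurry, h0])
    exact hp ⟨(p.1, p.2⁻¹ * p.1), ⟨subset_tsupport _ h1, subset_tsupport _ h2⟩, by simp⟩
  have c2 : Continuous (Function.uncurry fun x y : G =>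
      g (x * y) • modularCharacterFun y⁻¹ • f y) := by
    have := mc.comp (f := fun p : G × G => p.2⁻¹) (by fun_prop)
    simp only [Function.uncurry_def]
    exact (gc.comp (by fun_prop)).smul (this.smul (hf.comp (by fun_prop)))
  have s2 : HasCompactSupport (Function.uncurry fun x y : G =>
      g (x * y) • modularCharacterFun y⁻¹ • f y) := by
    have hK : IsCompact ((fun p : G × G => (p.1 * p.2⁻¹, p.2)) '' (tsupport g ×ˢ tsupport f)) :=
      (IsCompact.prod gs hf').image (by fun_prop)
    refine HasCompactSupport.intro hK fun p hp => ?_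
    by_contra h
    have h1 : g (p.1 * p.2) ≠ 0 := fun h0 => h (by simp [Function.uncurry, h0])
    have h2 : f p.2 ≠ 0 := fun h0 => h (by simp [Function.uncurry, h0])
    exact hp ⟨(p.1 * p.2, p.2), ⟨subset_tsupport _ h1, subset_tsupport _ h2⟩, by simp⟩
  -- Multiply by the integral of a test function `g`, substitute `x ↦ y⁻¹x`, swap, substitute `y ↦
  -- xy`, and swap again. The inner integral of `g(xy)` in `x` yields the modular factor of `y`,
  -- cancelling that of `y⁻¹`. Compact supports allow the swaps without σ-finiteness.
  have key : (∫ y, g y ∂μ) • ∫ x, modularCharacterFun x • f x⁻¹ ∂μ =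
      (∫ y, g y ∂μ) • ∫ x, f x ∂μ := by
    calc (∫ y, g y ∂μ) • ∫ x, modularCharacterFun x • f x⁻¹ ∂μ
        = ∫ y, ∫ x, g y • modularCharacterFun (y⁻¹ * x) • f (x⁻¹ * y) ∂μ ∂μ := by
          rw [← integral_smul_const]
          refine integral_congr_ae (Eventually.of_forall fun y => ?_)
          simp only
          rw [← integral_mul_left_eq_self (fun x => modularCharacterFun x • f x⁻¹) y⁻¹,
            integral_smul]
          simp
      _ = ∫ x, ∫ y, g y • modularCharacterFun (y⁻¹ * x) • f (x⁻¹ * y) ∂μ ∂μ :=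
          integral_integral_swap_of_hasCompactSupport c1 s1
      _ = ∫ x, ∫ y, g (x * y) • modularCharacterFun y⁻¹ • f y ∂μ ∂μ := by
          refine integral_congr_ae (Eventually.of_forall fun x => ?_)
          simp only
          rw [← integral_mul_left_eq_self
            (fun y => g y • modularCharacterFun (y⁻¹ * x) • f (x⁻¹ * y)) x]
          simp
      _ = ∫ y, ∫ x, g (x * y) • modularCharacterFun y⁻¹ • f y ∂μ ∂μ :=
          integral_integral_swap_of_hasCompactSupport c2 s2
      _ = _ := by
          rw [← integral_smul]
          refine integral_congr_ae (Eventually.of_forall fun y => ?_)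
          simp only
          have h1 : ∫ x, g (x * y) ∂μ = (modularCharacterFun y : ℝ) * ∫ x, g x ∂μ := by
            have h2 := ((Homeomorph.mulRight y).measurableEmbedding.integral_map (μ := μ) g)
            simp only [Homeomorph.coe_mulRight] at h2
            rw [← h2, map_mul_right_eq, integral_smul_nnreal_measure]
            simp [NNReal.smul_def]
          rw [integral_smul_const, h1, NNReal.smul_def, smul_smul]
          congr 1
          have := congrArg NNReal.toReal (mi y)
          push_cast at this
          rw [mul_right_comm, this, one_mul]
  exact smul_right_injective E hI key

omit [μ.Regular] in
/-- Symmetric nonnegative functions of integral one, supported near the identity. -/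
theorem exists_symmetric_bump {N : Set G} (hN : N ∈ 𝓝 (1 : G)) :
    ∃ h : G → ℝ, Continuous h ∧ HasCompactSupport h ∧ (∀ x, 0 ≤ h x) ∧ (∀ x, h x⁻¹ = h x) ∧
      ∫ x, h x ∂μ = 1 ∧ ∀ x ∉ N, h x = 0 := by
  obtain ⟨f, f1, f2, f3, f4⟩ := exists_continuousMap_one_of_isCompact_subset_isOpen
    (isCompact_singleton (x := (1 : G))) (isOpen_interior (s := N)) (by simpa [mem_interior_iff_mem_nhds] using hN)
  -- Symmetrization by a product rather than a sum keeps the support inside that of `f`.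
  let g : G → ℝ := fun x => f x * f x⁻¹
  have gc : Continuous g := by fun_prop
  have gs : HasCompactSupport g := HasCompactSupport.mul_right (f := f) (f' := fun x => f x⁻¹) f2
  have g0 : ∀ x, 0 ≤ g x := fun x => mul_nonneg (f4 x).1 (f4 x⁻¹).1
  have hI : 0 < ∫ x, g x ∂μ :=
    gc.integral_pos_of_hasCompactSupport_nonneg_nonzero gs g0 (x := 1) (by simp [g, f1 rfl])
  refine ⟨fun x => (∫ x, g x ∂μ)⁻¹ * g x, by fun_prop, gs.mul_left, fun x => ?_, fun x => ?_, ?_,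
    fun x hx => ?_⟩
  · exact mul_nonneg (inv_nonneg.2 hI.le) (g0 x)
  · simp [g, mul_comm]
  · rw [integral_const_mul, inv_mul_cancel₀ hI.ne']
  · have : f x = 0 := image_eq_zero_of_notMem_tsupport fun h => hx (interior_subset (f3 h))
    simp [g, this]

omit [μ.Regular] in
/-- A function that is continuous at a point is there approximated by its averages. -/
theorem exists_bump_near {E : Type*} [NormedAddCommGroup E] [NormedSpace ℝ E] [CompleteSpace E]
    {F : G → E} {g : G} (hF : ContinuousAt F g)
    (hi : ∀ h : G → ℝ, Continuous h → HasCompactSupport h → Integrable (fun x => h x • F x) μ)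
    {ε : ℝ} (hε : 0 < ε) :
    ∃ h : G → ℝ, Continuous h ∧ HasCompactSupport h ∧ (∀ x, 0 ≤ h x) ∧
      (∀ x, h (g * x⁻¹) = h (g * x)) ∧ ∫ x, h x ∂μ = 1 ∧ ‖∫ x, h x • F x ∂μ - F g‖ ≤ ε := by
  have hN : {x | ‖F (g * x) - F g‖ < ε} ∈ 𝓝 (1 : G) := by
    have h1 : ContinuousAt (fun x => F (g * x)) 1 :=
      ContinuousAt.comp (f := fun x => g * x) (g := F) (by simpa using hF) (by fun_prop)
    have := h1.eventually (Metric.ball_mem_nhds (F (g * 1)) hε)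
    simpa [dist_eq_norm] using! this
  obtain ⟨h, hc, hs, h0, hsym, h1, hN⟩ := exists_symmetric_bump μ hN
  have hc' : Continuous fun x => h (g⁻¹ * x) := by fun_prop
  have hs' : HasCompactSupport fun x => h (g⁻¹ * x) := hs.comp_homeomorph (Homeomorph.mulLeft g⁻¹)
  have h1' : ∫ x, h (g⁻¹ * x) ∂μ = 1 := by rw [integral_mul_left_eq_self h, h1]
  -- The symmetric bump at the identity is translated to `g`; left invariance keeps its integral
  -- equal to one.
  refine ⟨fun x => h (g⁻¹ * x), hc', hs', fun x => h0 _, fun x => by simp [hsym], h1', ?_⟩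
  have e1 : ∫ x, h (g⁻¹ * x) • F x ∂μ - F g = ∫ x, h (g⁻¹ * x) • (F x - F g) ∂μ := by
    simp_rw [smul_sub]
    rw [integral_sub (hi _ hc' hs')
      ((hc'.integrable_of_hasCompactSupport hs').smul_const _), integral_smul_const, h1', one_smul]
  rw [e1]
  calc ‖∫ x, h (g⁻¹ * x) • (F x - F g) ∂μ‖ ≤ ∫ x, h (g⁻¹ * x) * ε ∂μ := by
        refine norm_integral_le_of_norm_le
          ((hc'.integrable_of_hasCompactSupport hs').mul_const _) (Eventually.of_forall fun x => ?_)
        rw [norm_smul, Real.norm_of_nonneg (h0 _)]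
        by_cases hx : g⁻¹ * x ∈ {x | ‖F (g * x) - F g‖ < ε}
        · have : ‖F x - F g‖ < ε := by simpa using hx
          gcongr
          exact h0 _
        · rw [hN _ hx, zero_mul, zero_mul]
    _ = ε := by rw [integral_mul_const, h1', one_mul]

end Haar
end TwistedConvolution

end

section

open MeasureTheory Measure Topology Filter
open scoped NNReal ENNReal MultiplierAlgebra
open TwistedConvolution

namespace TwistedAction

/-! ### Integrals of compactly supported families with values in `L¹(G, A)`. -/

section CompactlySupported
variable {G A : Type*} [TopologicalSpace G] [T2Space G] [MeasurableSpace G] [BorelSpace G]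
  [NonUnitalCStarAlgebra A] [Group G] (T : TwistedAction G A) (μ : Measure G)
  [IsFiniteMeasureOnCompacts μ]

omit [TopologicalSpace G] [T2Space G] [MeasurableSpace G] [BorelSpace G]
  [Group G] in
theorem extend_val_of_notMem {K : Set G} (f : K → A) {x : G} (hx : x ∉ K) :
    Function.extend Subtype.val f 0 x = 0 :=
  Function.extend_apply' _ _ _ fun ⟨a, ha⟩ => hx (ha ▸ a.2)

omit [Group G] in
theorem integrable_extend {K : Set G} [CompactSpace K] (hK : IsCompact K) (f : C(K, A)) :
    Integrable (Function.extend Subtype.val f 0) μ ∧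
      ∫ x, ‖Function.extend Subtype.val f 0 x‖ ∂μ ≤ μ.real K * ‖f‖ := by
  have he : MeasurableEmbedding (Subtype.val : K → G) :=
    MeasurableEmbedding.subtype_coe hK.isClosed.measurableSet
  have h1 : StronglyMeasurable (Function.extend Subtype.val f (0 : G → A)) :=
    he.stronglyMeasurable_extend (f.continuous.stronglyMeasurable_of_hasCompactSupport
      (HasCompactSupport.of_compactSpace _)) stronglyMeasurable_zero
  have h2 : ∀ x, ‖Function.extend Subtype.val f (0 : G → A) x‖ ≤ K.indicator (fun _ => ‖f‖) x := by
    intro x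
    by_cases hx : x ∈ K
    · rw [Set.indicator_of_mem hx, Subtype.val_injective.extend_apply f 0 ⟨x, hx⟩]
      exact f.norm_coe_le_norm _
    · rw [Set.indicator_of_notMem hx, Function.extend_apply' _ _ _ (by simpa using hx)]
      simp
  have h3 : Integrable (K.indicator fun _ => ‖f‖) μ :=
    (integrable_indicator_iff hK.isClosed.measurableSet).2
      (integrableOn_const hK.measure_lt_top.ne)
  refine ⟨h3.mono' h1.aestronglyMeasurable (Eventually.of_forall h2), ?_⟩
  refine (integral_mono_of_nonneg (Eventually.of_forall fun x => norm_nonneg _) h3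
    (Eventually.of_forall h2)).trans ?_
  rw [integral_indicator hK.isClosed.measurableSet, setIntegral_const, smul_eq_mul]

omit [T2Space G] [BorelSpace G] [IsFiniteMeasureOnCompacts μ] in
theorem norm_mkL1 {f : G → A} (hf : Integrable f μ) : ‖T.mkL1 μ f hf‖ = ∫ x, ‖f x‖ ∂μ := by
  rw [L1.norm_eq]
  exact integral_congr_ae ((T.coeFn_mkL1 μ hf).mono fun x hx => by simp only [hx])

/-- Extension by zero, as a bounded linear map from `C(K, A)` to `L¹(G, A)`. -/
noncomputable def extendL {K : Set G} [CompactSpace K] (hK : IsCompact K) :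
    C(K, A) →L[ℂ] T.L1 μ :=
  LinearMap.mkContinuous
    { toFun := fun f => T.mkL1 μ _ (integrable_extend μ hK f).1
      map_add' := fun f g => by
        refine L1.ext' ?_
        filter_upwards [T.coeFn_mkL1 μ (integrable_extend μ hK (f + g)).1,
          T.coeFn_mkL1 μ (integrable_extend μ hK f).1, T.coeFn_mkL1 μ (integrable_extend μ hK g).1,
          L1.coeFn_add (T.mkL1 μ _ (integrable_extend μ hK f).1)
            (T.mkL1 μ _ (integrable_extend μ hK g).1)] with x h1 h2 h3 h4
        rw [h1, h4, Pi.add_apply, h2, h3]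
        by_cases hx : x ∈ K
        · simp only [Subtype.val_injective.extend_apply _ _ (⟨x, hx⟩ : K)]
          rfl
        · simp only [extend_val_of_notMem _ hx, add_zero]
      map_smul' := fun c f => by
        refine L1.ext' ?_
        filter_upwards [T.coeFn_mkL1 μ (integrable_extend μ hK (c • f)).1,
          T.coeFn_mkL1 μ (integrable_extend μ hK f).1,
          L1.coeFn_smul c (T.mkL1 μ _ (integrable_extend μ hK f).1)] with x h1 h2 h4
        rw [RingHom.id_apply, h1, h4, Pi.smul_apply, h2]
        by_cases hx : x ∈ K
        · simp only [Subtype.val_injective.extend_apply _ _ (⟨x, hx⟩ : K)]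
          rfl
        · simp only [extend_val_of_notMem _ hx, smul_zero] }
    (μ.real K) (fun f => by
      change ‖T.mkL1 μ _ (integrable_extend μ hK f).1‖ ≤ _
      rw [norm_mkL1]
      exact (integrable_extend μ hK f).2)

omit [T2Space G] [BorelSpace G] [IsFiniteMeasureOnCompacts μ] in
theorem mkL1_congr {f g : G → A} (hf : Integrable f μ) (hg : Integrable g μ) (h : f = g) :
    T.mkL1 μ f hf = T.mkL1 μ g hg := by
  subst h
  rfl

/-- A compactly supported continuous family of functions is a continuous family in `L¹`, and its integral can be computed pointwise. -/
theorem integral_mkL1 {θ : G → G → A} (hc : Continuous (Function.uncurry θ))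
    (hs : HasCompactSupport (Function.uncurry θ)) (hi : ∀ y, Integrable (θ y) μ)
    (hI : Integrable (fun x => ∫ y, θ y x ∂μ) μ) :
    Continuous (fun y => T.mkL1 μ (θ y) (hi y)) ∧
      ∫ y, T.mkL1 μ (θ y) (hi y) ∂μ = T.mkL1 μ (fun x => ∫ y, θ y x ∂μ) hI := by
  have hK : IsCompact (Prod.snd '' tsupport (Function.uncurry θ)) := hs.image continuous_snd
  set K := Prod.snd '' tsupport (Function.uncurry θ)
  have : CompactSpace K := isCompact_iff_compactSpace.1 hK
  have h0 : ∀ y, ∀ x ∉ K, θ y x = 0 := fun y x hx => by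
    by_contra h
    exact hx ⟨(y, x), subset_tsupport _ h, rfl⟩
  -- Evaluation at a point makes no sense on classes in `L¹`, but is bounded on `C(K, A)`. So the
  -- family is integrated in `C(K, A)`, where evaluation commutes with the integral, and then mapped
  -- to `L¹` by the bounded operator `extendL`.
  let c : C(G, C(K, A)) := ContinuousMap.curry
    ⟨fun p : G × K => θ p.1 p.2, hc.comp (f := fun p : G × K => (p.1, (p.2 : G))) (by fun_prop)⟩
  have hcs : HasCompactSupport c := by
    refine HasCompactSupport.intro (hs.image continuous_fst) fun y hy => ?_
    ext x
    by_contra h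
    exact hy ⟨(y, x), subset_tsupport _ h, rfl⟩
  have e1 : ∀ y, T.mkL1 μ (θ y) (hi y) = T.extendL μ hK (c y) := fun y => by
    refine T.mkL1_congr μ _ (integrable_extend μ hK _).1 (funext fun x => ?_)
    by_cases hx : x ∈ K
    · rw [Subtype.val_injective.extend_apply _ _ (⟨x, hx⟩ : K)]
      rfl
    · rw [extend_val_of_notMem _ hx, h0 y x hx]
  simp_rw [e1]
  have hci : Integrable c μ := c.continuous.integrable_of_hasCompactSupport hcs
  refine ⟨(T.extendL μ hK).continuous.comp c.continuous, ?_⟩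
  rw [(T.extendL μ hK).integral_comp_comm hci]
  refine T.mkL1_congr μ (integrable_extend μ hK _).1 _ (funext fun x => ?_)
  by_cases hx : x ∈ K
  · rw [Subtype.val_injective.extend_apply _ _ (⟨x, hx⟩ : K)]
    exact ((ContinuousMap.evalCLM ℂ (⟨x, hx⟩ : K)).integral_comp_comm hci).symm
  · rw [extend_val_of_notMem _ hx]
    simp [h0 _ x hx]

end CompactlySupported

/-! ### Multipliers of `A` acting on `L¹(G, A)`. -/

section Multipliers
variable {G A : Type*} [Group G] [TopologicalSpace G] [NonUnitalCStarAlgebra A]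
  [MeasurableSpace G] (T : TwistedAction G A) (μ : Measure G)

/-- The action of multipliers of `A` on `L¹(G, A)` by pointwise multiplication from the left. -/
noncomputable def lam : 𝓜(ℂ, A) →L[ℂ] T.L1 μ →L[ℂ] T.L1 μ :=
  LinearMap.mkContinuous₂
    (LinearMap.mk₂ ℂ (fun (m : 𝓜(ℂ, A)) (Ψ : T.L1 μ) => (m.fst.compLpL 1 μ : Lp A 1 μ → Lp A 1 μ) Ψ)
      (fun m m' Ψ => m.fst.add_compLp m'.fst Ψ) (fun c m Ψ => m.fst.smul_compLp c Ψ)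
      (fun m Ψ Ψ' => map_add (m.fst.compLpL 1 μ) _ _)
      (fun c m Ψ => map_smul (m.fst.compLpL 1 μ) _ _)) 1
    (fun m Ψ => by
      rw [one_mul, ← DoubleCentralizer.norm_fst]
      exact m.fst.norm_compLp_le Ψ)

theorem norm_lam_le (m : 𝓜(ℂ, A)) (Ψ : T.L1 μ) : ‖T.lam μ m Ψ‖ ≤ ‖m‖ * ‖Ψ‖ := by
  rw [← DoubleCentralizer.norm_fst]
  exact m.fst.norm_compLp_le Ψ

theorem coeFn_lam (m : 𝓜(ℂ, A)) (Ψ : T.L1 μ) : T.lam μ m Ψ =ᵐ[μ] fun x => m.fst (Ψ x) :=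
  m.fst.coeFn_compLp Ψ

theorem lam_mul (m n : 𝓜(ℂ, A)) (Ψ : T.L1 μ) : T.lam μ (m * n) Ψ = T.lam μ m (T.lam μ n Ψ) := by
  refine L1.ext' ?_
  filter_upwards [T.coeFn_lam μ (m * n) Ψ, T.coeFn_lam μ m (T.lam μ n Ψ), T.coeFn_lam μ n Ψ]
    with x h1 h2 h3
  rw [h1, h2, h3]
  rfl

theorem lam_one (Ψ : T.L1 μ) : T.lam μ 1 Ψ = Ψ := by
  refine L1.ext' ?_
  filter_upwards [T.coeFn_lam μ 1 Ψ] with x h1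
  rw [h1]
  rfl

theorem norm_coe_le (a : A) : ‖(a : 𝓜(ℂ, A))‖ ≤ ‖a‖ :=
  NonUnitalStarAlgHom.norm_apply_le (DoubleCentralizer.coeHom (𝕜 := ℂ) (A := A)) a

theorem continuous_coe : Continuous fun a : A => (a : 𝓜(ℂ, A)) :=
  AddMonoidHomClass.continuous_of_bound (DoubleCentralizer.coeHom (𝕜 := ℂ) (A := A)) 1 fun a => by
    rw [one_mul]
    exact norm_coe_le a

/-- Used to absorb a multiplier into `A`, which is an ideal of its multiplier algebra. -/
theorem coe_mul_coe (m : 𝓜(ℂ, A)) (a : A) : m * (a : 𝓜(ℂ, A)) = (m.fst a : A) := by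
  refine DoubleCentralizer.ext ℂ A _ _ (Prod.ext ?_ ?_) <;> ext b
  · exact fst_mul m a b
  · exact m.central b a

theorem lam_coe_zero (Ψ : T.L1 μ) : T.lam μ ((0 : A) : 𝓜(ℂ, A)) Ψ = 0 := by
  have : ((0 : A) : 𝓜(ℂ, A)) = 0 := map_zero (DoubleCentralizer.coeHom (𝕜 := ℂ) (A := A))
  rw [this, map_zero, zero_apply]

end Multipliers

/-! ### The pointwise twisted shift. -/

section Shift
variable {G A : Type*} [Group G] [TopologicalSpace G]
  [NonUnitalCStarAlgebra A] (T : TwistedAction G A)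

/-- The map `b ↦ α_g(b) ω(g, g⁻¹x)`. -/
noncomputable def shift (g x : G) (b : A) : A :=
  (T.ω g (g⁻¹ * x) : 𝓜(ℂ, A)).snd (T.α g b)

theorem kernel_eq_mul_shift (g x : G) (a b : A) : T.kernel g x a b = a * T.shift g x b :=
  snd_mul _ _ _

theorem norm_shift_le (g x : G) (b : A) : ‖T.shift g x b‖ ≤ ‖b‖ :=
  (norm_snd_le _ _).trans (StarAlgEquiv.norm_map _ _).le

theorem shift_zero (g x : G) : T.shift g x 0 = 0 := by simp [shift]

theorem continuous_shift [IsTopologicalGroup G] :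
    Continuous fun p : (G × G) × A => T.shift p.1.1 p.1.2 p.2 := by
  have h1 : Continuous fun p : (G × G) × A => T.α p.1.1 p.2 :=
    T.continuous_α_prod.comp (f := fun p : (G × G) × A => (p.1.1, p.2)) (by fun_prop)
  exact T.continuous_ω_right_prod.comp
    (f := fun p : (G × G) × A => ((p.1.1, p.1.1⁻¹ * p.1.2), T.α p.1.1 p.2)) (by fun_prop)

theorem shift_mul (g x : G) (a b : A) : T.shift g x (a * b) = T.α g a * T.shift g x b := by
  simp [shift, snd_mul]

/-- This is associativity `u(av) = (ua)v`, tested by multiplying on the right by elements of `A`. -/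
theorem fst_snd_comm (u v : 𝓜(ℂ, A)) (a : A) : u.fst (v.snd a) = v.snd (u.fst a) :=
  eq_of_forall_mul_eq fun c => by
    rw [← fst_mul, v.central, fst_mul, v.central]

/-- With `w = h⁻¹g⁻¹x`, the left side is `α_g(α_h(b)) α_g(ω(h,w)) ω(g,hw)`. The cocycle identity
turns the last two factors into `ω(g,h) ω(gh,w)`, and the twist identity moves `ω(g,h)` to the
front. -/
theorem shift_shift (g h x : G) (b : A) :
    T.shift g x (T.shift h (g⁻¹ * x) b) = (T.ω g h : 𝓜(ℂ, A)).fst (T.shift (g * h) x b) := by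
  simp only [shift]
  set w := h⁻¹ * (g⁻¹ * x) with hw
  have h1 : g⁻¹ * x = h * w := by rw [hw]; group
  have h2 : (g * h)⁻¹ * x = w := by rw [hw]; group
  rw [h1, h2, fst_snd_comm, ← twist_apply]
  have e2 : T.α g ((T.ω h w : 𝓜(ℂ, A)).snd (T.α h b)) =
    (extendAut (T.α g) (T.ω h w)).snd (T.α g (T.α h b)) := by simp [extendAut]
  rw [e2]
  exact congrArg (fun m : 𝓜(ℂ, A) => m.snd (T.α g (T.α h b))) (T.cocycle g h w)

end Shift

/-! ### Twisted translations, and the product as an integrated form. -/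

section Translation
variable {G A : Type*} [Group G] [TopologicalSpace G] [IsTopologicalGroup G]
  [LocallyCompactSpace G] [MeasurableSpace G] [BorelSpace G]
  [NonUnitalCStarAlgebra A] (T : TwistedAction G A)
  (μ : Measure G) [μ.IsHaarMeasure] [μ.Regular]

omit [LocallyCompactSpace G] [μ.Regular] in
theorem tendsto_mul_left_ae (g : G) : Tendsto (fun x => g * x) (ae μ) (ae μ) :=
  (measurePreserving_mul_left μ g).quasiMeasurePreserving.tendsto_ae

/-- The norm bound is pointwise. Strong measurability comes from `aestronglyMeasurable_fiberwise`,
which approximates by continuous compactly supported functions, since `G` need not be second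
countable. -/
theorem integrable_shift (g : G) {Ψ : G → A} (hΨ : Integrable Ψ μ) :
    Integrable (fun x => T.shift g x (Ψ (g⁻¹ * x))) μ := by
  have h1 : Integrable (fun x => Ψ (g⁻¹ * x)) μ := hΨ.comp_mul_left g⁻¹
  have h2 := aestronglyMeasurable_fiberwise μ (h := fun x b => T.shift g x b)
    (T.continuous_shift.comp (f := fun p : G × A => ((g, p.1), p.2)) (by fun_prop))
    (fun x => T.shift_zero g x) h1
  exact h1.mono h2 (Eventually.of_forall fun x => T.norm_shift_le _ _ _)

/-- The twisted left translation `(U_g Ψ)(x) = α_g(Ψ(g⁻¹x)) ω(g, g⁻¹x)`. -/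
noncomputable def transl (g : G) : T.L1 μ →L[ℂ] T.L1 μ :=
  LinearMap.mkContinuous
    { toFun := fun Ψ => T.mkL1 μ _ (T.integrable_shift μ g Ψ.integrable)
      map_add' := fun Ψ Ψ' => by
        refine L1.ext' ?_
        filter_upwards [T.coeFn_mkL1 μ (T.integrable_shift μ g (Ψ + Ψ').integrable),
          T.coeFn_mkL1 μ (T.integrable_shift μ g Ψ.integrable),
          T.coeFn_mkL1 μ (T.integrable_shift μ g Ψ'.integrable),
          L1.coeFn_add (T.mkL1 μ _ (T.integrable_shift μ g Ψ.integrable))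
            (T.mkL1 μ _ (T.integrable_shift μ g Ψ'.integrable)),
          (tendsto_mul_left_ae μ g⁻¹).eventually (L1.coeFn_add Ψ Ψ')] with x h1 h2 h3 h4 h5
        rw [h1, h4, Pi.add_apply, h2, h3, h5]
        simp [shift]
      map_smul' := fun c Ψ => by
        refine L1.ext' ?_
        filter_upwards [T.coeFn_mkL1 μ (T.integrable_shift μ g (c • Ψ).integrable),
          T.coeFn_mkL1 μ (T.integrable_shift μ g Ψ.integrable),
          L1.coeFn_smul c (T.mkL1 μ _ (T.integrable_shift μ g Ψ.integrable)),
          (tendsto_mul_left_ae μ g⁻¹).eventually (L1.coeFn_smul c Ψ)] with x h1 h2 h4 h5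
        rw [RingHom.id_apply, h1, h4, Pi.smul_apply, h2, h5]
        simp [shift] }
    1 (fun Ψ => by
      change ‖T.mkL1 μ _ (T.integrable_shift μ g Ψ.integrable)‖ ≤ _
      rw [norm_mkL1, one_mul, L1.norm_eq, ← integral_mul_left_eq_self (fun x => ‖Ψ x‖) g⁻¹]
      exact integral_mono (T.integrable_shift μ g Ψ.integrable).norm
        (Ψ.integrable.comp_mul_left g⁻¹).norm fun x => T.norm_shift_le _ _ _)

theorem norm_transl_le (g : G) (Ψ : T.L1 μ) : ‖T.transl μ g Ψ‖ ≤ ‖Ψ‖ := by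
  refine ((T.transl μ g).le_opNorm Ψ).trans (mul_le_of_le_one_left (norm_nonneg _) ?_)
  exact LinearMap.mkContinuous_norm_le _ zero_le_one _

theorem coeFn_transl (g : G) (Ψ : T.L1 μ) :
    T.transl μ g Ψ =ᵐ[μ] fun x => T.shift g x (Ψ (g⁻¹ * x)) :=
  T.coeFn_mkL1 μ (T.integrable_shift μ g Ψ.integrable)

theorem transl_congr (g : G) {Ψ : T.L1 μ} {ψ : G → A} (h : Ψ =ᵐ[μ] ψ) :
    T.transl μ g Ψ =ᵐ[μ] fun x => T.shift g x (ψ (g⁻¹ * x)) := by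
  filter_upwards [T.coeFn_transl μ g Ψ, (tendsto_mul_left_ae μ g⁻¹).eventually h] with x h1 h2
  rw [h1, h2]

/-- The translations form a projective representation with multiplier `ω`; together with
`transl_lam` this is the covariance relation behind the adjoint formula in `rep_star_mul_transl`. -/
theorem transl_transl (g h : G) (Ψ : T.L1 μ) :
    T.transl μ g (T.transl μ h Ψ) = T.lam μ (T.ω g h) (T.transl μ (g * h) Ψ) := by
  refine L1.ext' ?_
  filter_upwards [T.transl_congr μ g (T.coeFn_transl μ h Ψ),
    T.coeFn_lam μ (T.ω g h) (T.transl μ (g * h) Ψ), T.coeFn_transl μ (g * h) Ψ] with x h1 h2 h3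
  rw [h1, h2, h3, shift_shift]
  simp [mul_assoc]

theorem transl_lam (g : G) (a : A) (Ψ : T.L1 μ) :
    T.transl μ g (T.lam μ a Ψ) = T.lam μ (T.α g a : A) (T.transl μ g Ψ) := by
  refine L1.ext' ?_
  filter_upwards [T.transl_congr μ g (T.coeFn_lam μ a Ψ),
    T.coeFn_lam μ (T.α g a : A) (T.transl μ g Ψ), T.coeFn_transl μ g Ψ] with x h1 h2 h3
  rw [h1, h2, h3]
  exact T.shift_mul g x a _

theorem transl_one (Ψ : T.L1 μ) : T.transl μ 1 Ψ = Ψ := by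
  refine L1.ext' ?_
  filter_upwards [T.coeFn_transl μ 1 Ψ] with x h1
  rw [h1]
  simp [shift, T.ω_one_left, T.α_one]

variable [T2Space G]

/-- A continuous family of functions, with locally uniformly compact supports, is continuous
in `L¹`. -/
theorem continuous_mkL1 {θ : G → G → A} (hc : Continuous (Function.uncurry θ))
    (hs : ∀ K : Set G, IsCompact K → ∃ K' : Set G, IsCompact K' ∧ ∀ y ∈ K, ∀ x ∉ K', θ y x = 0)
    (hi : ∀ y, Integrable (θ y) μ) : Continuous fun y => T.mkL1 μ (θ y) (hi y) := by
  refine continuous_iff_continuousAt.2 fun g => ?_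
  obtain ⟨K, hK, hgK⟩ := exists_compact_mem_nhds g
  obtain ⟨f, f1, f2, -, -⟩ := exists_continuousMap_one_of_isCompact_subset_isOpen hK isOpen_univ
    (Set.subset_univ K)
  obtain ⟨K', hK', hθ⟩ := hs _ f2
  -- Cutting off in the parameter makes the family jointly compactly supported without changing it
  -- near `g`, so `integral_mkL1` applies.
  let θ' : G → G → A := fun y x => f y • θ y x
  have hc' : Continuous (Function.uncurry θ') := (f.continuous.comp continuous_fst).smul hc
  have hs' : HasCompactSupport (Function.uncurry θ') := by
    refine HasCompactSupport.intro (IsCompact.prod f2 hK') fun p hp => ?_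
    by_contra h
    have h1 : p.1 ∈ tsupport f := subset_tsupport _ fun h0 => h (by simp [θ', Function.uncurry, h0])
    exact h (by simp [θ', Function.uncurry, hθ _ h1 _ fun h2 => hp ⟨h1, h2⟩])
  have hI := continuous_integral_of_compact μ hc' hs'
  have key := (T.integral_mkL1 μ hc' hs' (fun y => (hi y).smul (f y))
    (hI.1.integrable_of_hasCompactSupport hI.2)).1
  refine key.continuousAt.congr ?_
  filter_upwards [hgK] with y hy
  refine T.mkL1_congr μ _ _ ?_
  simp [θ', f1 hy]

-- The translations are uniformly contractive, so continuity need only be checked on the dense set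
-- of classes of continuous compactly supported functions, where `continuous_mkL1` gives it.
open scoped Pointwise in
theorem continuous_transl (Ψ : T.L1 μ) : Continuous fun g => T.transl μ g Ψ := by
  let S : Set (T.L1 μ) := {Ψ | ∃ ψ : G → A, Continuous ψ ∧ HasCompactSupport ψ ∧ Ψ =ᵐ[μ] ψ}
  have hS : Dense S := fun Ψ => L1.induction_compact (P := fun Ψ => Ψ ∈ closure S) isClosed_closure
    (fun φ h1 h2 Φ h3 => subset_closure ⟨φ, h1, h2, h3⟩) Ψ
  have key := continuous_prod_of_dense_continuous_lipschitzWith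
    (fun p : T.L1 μ × G => T.transl μ p.2 p.1) 1 hS ?_
    (fun g => LipschitzWith.of_dist_le_mul fun Ψ Ψ' => ?_)
  · exact key.comp (continuous_const.prodMk continuous_id)
  · rintro Ψ ⟨ψ, ψc, ψs, hψ⟩
    have ψi : Integrable ψ μ := ψc.integrable_of_hasCompactSupport ψs
    have e : ∀ g, T.transl μ g Ψ = T.mkL1 μ _ (T.integrable_shift μ g ψi) := fun g =>
      L1.ext' ((T.transl_congr μ g hψ).trans (T.coeFn_mkL1 μ (T.integrable_shift μ g ψi)).symm)
    simp only [e]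
    refine T.continuous_mkL1 μ (θ := fun g x => T.shift g x (ψ (g⁻¹ * x))) ?_ (fun K hK => ?_) _
    · exact T.continuous_shift.comp
        (f := fun p : G × G => ((p.1, p.2), ψ (p.1⁻¹ * p.2))) (by fun_prop)
    · refine ⟨K * tsupport ψ, hK.mul ψs, fun y hy x hx => ?_⟩
      rw [image_eq_zero_of_notMem_tsupport (f := ψ), T.shift_zero]
      exact fun h => hx ⟨y, hy, _, h, by simp⟩
  · simp only [dist_eq_norm, NNReal.coe_one, one_mul]
    rw [← map_sub]
    exact T.norm_transl_le μ g _

/-- The right side is an `L¹`-valued Bochner integral, so it passes through bounded operators such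
as the quotient map. Both sides are continuous in `Ψ`; for `Ψ` continuous with compact support the
integrand is the convolution kernel and `integral_mkL1` identifies the two. -/
theorem mul_eq_integral {φ : G → A} (φc : Continuous φ) (φs : HasCompactSupport φ) {Φ : T.L1 μ}
    (hΦ : Φ =ᵐ[μ] φ) (Ψ : T.L1 μ) :
    Integrable (fun y => T.lam μ (φ y : A) (T.transl μ y Ψ)) μ ∧
      Φ * Ψ = ∫ y, T.lam μ (φ y : A) (T.transl μ y Ψ) ∂μ := by
  have hi : ∀ Ψ : T.L1 μ, Integrable (fun y => T.lam μ (φ y : A) (T.transl μ y Ψ)) μ := fun Ψ => by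
    refine Continuous.integrable_of_hasCompactSupport ?_
      (HasCompactSupport.intro φs fun y hy => ?_)
    · exact ((T.lam μ).continuous.comp (continuous_coe.comp φc)).clm_apply (T.continuous_transl μ Ψ)
    · rw [image_eq_zero_of_notMem_tsupport hy]
      exact T.lam_coe_zero μ _
  refine ⟨hi Ψ, ?_⟩
  have hφi : Integrable φ μ := φc.integrable_of_hasCompactSupport φs
  -- The right side is Lipschitz in `Ψ` with constant the `L¹` norm of `φ`.
  have hlip : Continuous fun Ψ : T.L1 μ => ∫ y, T.lam μ (φ y : A) (T.transl μ y Ψ) ∂μ := by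
    refine (LipschitzWith.of_dist_le_mul (K := ⟨∫ y, ‖φ y‖ ∂μ, integral_nonneg fun y => norm_nonneg _⟩)
      fun Ψ Ψ' => ?_).continuous
    rw [dist_eq_norm, dist_eq_norm, ← integral_sub (hi Ψ) (hi Ψ')]
    refine (norm_integral_le_of_norm_le (hφi.norm.mul_const ‖Ψ - Ψ'‖)
      (Eventually.of_forall fun y => ?_)).trans_eq (integral_mul_const _ _)
    rw [← map_sub, ← map_sub]
    refine (T.norm_lam_le μ _ _).trans ?_
    gcongr
    · exact norm_coe_le _
    · exact T.norm_transl_le μ _ _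
  refine L1.induction_compact (P := fun Ψ => Φ * Ψ = ∫ y, T.lam μ (φ y : A) (T.transl μ y Ψ) ∂μ)
    (isClosed_eq (by fun_prop) hlip) (fun ψ ψc ψs Ψ hΨ => ?_) Ψ
  have tc := T.continuous_integrand φc ψc
  have ts := T.hasCompactSupport_integrand φs ψs
  have ti : ∀ y, Integrable (fun x => T.kernel y x (φ y) (ψ (y⁻¹ * x))) μ := fun y =>
    (tc.comp (continuous_const.prodMk continuous_id)).integrable_of_hasCompactSupport
      (HasCompactSupport.intro (ts.image continuous_snd) fun x hx => by
        by_contra h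
        exact hx ⟨(y, x), subset_tsupport _ h, rfl⟩)
  have hI := continuous_integral_of_compact μ tc ts
  have e1 := (T.integral_mkL1 μ tc ts ti (hI.1.integrable_of_hasCompactSupport hI.2)).2
  have e2 : ∀ y, T.lam μ (φ y : A) (T.transl μ y Ψ) = T.mkL1 μ _ (ti y) := fun y => by
    refine L1.ext' ?_
    filter_upwards [T.coeFn_lam μ (φ y : A) (T.transl μ y Ψ), T.transl_congr μ y hΨ,
      T.coeFn_mkL1 μ (ti y)] with x h1 h2 h3
    rw [h1, h2, h3, kernel_eq_mul_shift]
    rfl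
  simp_rw [e2, e1]
  refine L1.ext' ((L1.coeFn_mul Φ Ψ).trans ?_)
  rw [T.conv_congr μ hΦ hΨ]
  exact (T.coeFn_mkL1 μ _).symm

end Translation
end TwistedAction

end

/-! ### Approximate units of `L¹(G, A)` and invariance of closed ideals. -/

section

open MeasureTheory Measure Topology Filter
open scoped NNReal ENNReal MultiplierAlgebra
open TwistedConvolution

namespace TwistedConvolution

/-- An `ε / 3` argument using that all `R i` are 1-Lipschitz. It reduces approximate unit statements
to continuous compactly supported functions. -/
theorem isClosed_setOf_approx {E ι : Type*} [SeminormedAddCommGroup E] (R : ι → E → E)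
    (hR : ∀ i x y, ‖R i x - R i y‖ ≤ ‖x - y‖) :
    IsClosed {x | ∀ ε : ℝ, 0 < ε → ∃ i, ‖R i x - x‖ ≤ ε} := by
  refine isClosed_of_closure_subset fun x hx ε hε => ?_
  obtain ⟨y, hy, hxy⟩ := Metric.mem_closure_iff.1 hx (ε / 3) (by positivity)
  obtain ⟨i, hi⟩ := hy (ε / 3) (by positivity)
  refine ⟨i, ?_⟩
  rw [dist_eq_norm] at hxy
  have h1 : R i x - x = (R i x - R i y) + (R i y - y) - (x - y) := by abel
  rw [h1]
  have h2 := norm_sub_le ((R i x - R i y) + (R i y - y)) (x - y)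
  have h3 := norm_add_le (R i x - R i y) (R i y - y)
  have h4 := hR i x y
  linarith

end TwistedConvolution

namespace TwistedAction
variable {G A : Type*} [Group G] [TopologicalSpace G] [IsTopologicalGroup G]
  [LocallyCompactSpace G] [T2Space G] [MeasurableSpace G] [BorelSpace G]
  [NonUnitalCStarAlgebra A] (T : TwistedAction G A)
  (μ : Measure G) [μ.IsHaarMeasure] [μ.Regular]

theorem norm_mkL1_sub_le {φ ψ : G → A} (hφ : Integrable φ μ)
    {Ψ : T.L1 μ} (hΨ : Ψ =ᵐ[μ] ψ) {K : Set G} (hK : IsCompact K) {ε : ℝ}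
    (h1 : ∀ x ∈ K, ‖φ x - ψ x‖ ≤ ε) (h2 : ∀ x ∉ K, φ x = ψ x) :
    ‖T.mkL1 μ φ hφ - Ψ‖ ≤ ε * μ.real K := by
  rw [L1.norm_eq]
  have e : ∀ᵐ x ∂μ, ‖(T.mkL1 μ φ hφ - Ψ) x‖ ≤ K.indicator (fun _ => ε) x := by
    filter_upwards [L1.coeFn_sub (T.mkL1 μ φ hφ) Ψ, T.coeFn_mkL1 μ hφ, hΨ] with x g1 g2 g3
    rw [g1, Pi.sub_apply, g2, g3]
    by_cases hx : x ∈ K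
    · rw [Set.indicator_of_mem hx]
      exact h1 x hx
    · rw [Set.indicator_of_notMem hx, h2 x hx, sub_self, norm_zero]
  have hi : Integrable (K.indicator fun _ => ε) μ :=
    (integrable_indicator_iff hK.isClosed.measurableSet).2 (integrableOn_const hK.measure_lt_top.ne)
  refine (integral_mono_of_nonneg (Eventually.of_forall fun x => norm_nonneg _) hi e).trans_eq ?_
  rw [integral_indicator hK.isClosed.measurableSet, setIntegral_const, smul_eq_mul, mul_comm]

/-- Approximate units of `A` are left approximate units for `L¹(G, A)`. -/
theorem exists_lam_near (Ψ : T.L1 μ) {ε : ℝ} (hε : 0 < ε) :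
    ∃ a : A, ‖a‖ ≤ 1 ∧ ‖T.lam μ a Ψ - Ψ‖ ≤ ε := by
  have hcl := isClosed_setOf_approx (fun (a : {a : A // ‖a‖ ≤ 1}) (Ψ : T.L1 μ) => T.lam μ a.1 Ψ)
    (fun a Ψ Ψ' => by
      rw [← map_sub]
      exact (T.norm_lam_le μ _ _).trans
        (mul_le_of_le_one_left (norm_nonneg _) ((norm_coe_le _).trans a.2)))
  refine (fun ⟨a, ha⟩ => ⟨a.1, a.2, ha⟩ :
    (∃ a : {a : A // ‖a‖ ≤ 1}, ‖T.lam μ a.1 Ψ - Ψ‖ ≤ ε) → _) ?_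
  refine L1.induction_compact hcl (fun ψ ψc ψs Ψ hΨ ε hε => ?_) Ψ ε hε
  have hM : 0 ≤ μ.real (tsupport ψ) := measureReal_nonneg
  -- The range of `ψ` is compact, so one `a` serves all its values. The added `1` keeps the
  -- denominator positive when the support is null.
  obtain ⟨a, ha, haS⟩ := exists_approximateUnit_of_isCompact (ψs.isCompact_range ψc)
    (show 0 < ε / (μ.real (tsupport ψ) + 1) by positivity)
  have hi : Integrable (fun x => a * ψ x) μ :=
    (continuous_const.mul ψc).integrable_of_hasCompactSupport ψs.mul_left
  have e : T.lam μ a Ψ = T.mkL1 μ _ hi := by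
    refine L1.ext' ?_
    filter_upwards [T.coeFn_lam μ a Ψ, T.coeFn_mkL1 μ hi, hΨ] with x h1 h2 h3
    rw [h1, h2, h3]
    rfl
  refine ⟨⟨a, ha⟩, ?_⟩
  rw [e]
  refine (T.norm_mkL1_sub_le μ hi hΨ ψs (fun x _ => (haS _ ⟨x, rfl⟩).1) fun x hx => ?_).trans ?_
  · rw [image_eq_zero_of_notMem_tsupport hx, mul_zero]
  · rw [div_mul_eq_mul_div, div_le_iff₀ (by positivity)]
    nlinarith

/-- Elements `a U_g Ψ` belong to the closed left ideal generated by `Ψ`. -/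
theorem exists_mul_near (g : G) (a : A) (Ψ : T.L1 μ) {ε : ℝ} (hε : 0 < ε) :
    ∃ E : T.L1 μ, ‖E * Ψ - T.lam μ a (T.transl μ g Ψ)‖ ≤ ε := by
  have hF : Continuous fun y => T.lam μ a (T.transl μ y Ψ) :=
    (T.lam μ a).continuous.comp (T.continuous_transl μ Ψ)
  -- With `E = h a`, the product `E * Ψ` is the average of `y ↦ a U_y Ψ` against `h`, hence close to
  -- its value at `g`.
  obtain ⟨h, hc, hs, -, -, -, hle⟩ := exists_bump_near μ hF.continuousAt (g := g)
    (fun h hc hs => (hc.smul hF).integrable_of_hasCompactSupport hs.smul_right) hε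
  have φc : Continuous fun y => (h y : ℂ) • a := by fun_prop
  have φs : HasCompactSupport fun y => (h y : ℂ) • a := hs.mono fun y hy h0 => hy (by simp [h0])
  refine ⟨T.mkL1 μ _ (φc.integrable_of_hasCompactSupport φs), ?_⟩
  rw [(T.mul_eq_integral μ φc φs (T.coeFn_mkL1 μ _) Ψ).2]
  have e : ∀ y, T.lam μ ((h y : ℂ) • a : A) (T.transl μ y Ψ) =
      h y • T.lam μ a (T.transl μ y Ψ) := fun y => by
    have : (((h y : ℂ) • a : A) : 𝓜(ℂ, A)) = (h y : ℂ) • (a : 𝓜(ℂ, A)) :=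
      map_smul (DoubleCentralizer.coeHom (𝕜 := ℂ) (A := A)) _ _
    rw [this, map_smul, _root_.smul_apply, Complex.coe_smul]
  simpa only [e] using hle

-- Applying the isometry `α_x` to the difference of the values at `x` and `x₀` leaves `φ(x) -
-- α_x(α_{x₀}⁻¹(φ(x₀)))`, where only `α` itself, not its inverse, depends on `x`.
omit [IsTopologicalGroup G] [LocallyCompactSpace G] [T2Space G] [MeasurableSpace G]
  [BorelSpace G] in
theorem continuous_symm_α {φ : G → A} (hφ : Continuous φ) :
    Continuous fun x => (T.α x).symm (φ x) := by
  refine continuous_iff_continuousAt.2 fun x₀ => ?_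
  rw [ContinuousAt, tendsto_iff_norm_sub_tendsto_zero]
  have h1 : Continuous fun x => ‖φ x - T.α x ((T.α x₀).symm (φ x₀))‖ :=
    (hφ.sub (T.continuous_α _)).norm
  have h2 := h1.tendsto x₀
  simp only [StarAlgEquiv.apply_symm_apply, sub_self, norm_zero] at h2
  refine h2.congr fun x => ?_
  rw [← StarAlgEquiv.norm_map (T.α x) ((T.α x).symm (φ x) - _), map_sub,
    StarAlgEquiv.apply_symm_apply]

/-- `L¹(G, A)` has contractive right approximate units. -/
theorem exists_mul_right_near (Φ : T.L1 μ) {ε : ℝ} (hε : 0 < ε) :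
    ∃ E : T.L1 μ, ‖Φ * E - Φ‖ ≤ ε := by
  have hcl := isClosed_setOf_approx (fun (E : {E : T.L1 μ // ‖E‖ ≤ 1}) (Φ : T.L1 μ) => Φ * E.1)
    (fun E Φ Φ' => by
      rw [← sub_mul]
      exact (norm_mul_le _ _).trans (mul_le_of_le_one_right (norm_nonneg _) E.2))
  refine (fun ⟨E, hE⟩ => ⟨E.1, hE⟩ :
    (∃ E : {E : T.L1 μ // ‖E‖ ≤ 1}, ‖Φ * E.1 - Φ‖ ≤ ε) → _) ?_
  refine L1.induction_compact hcl (fun φ φc φs Φ hΦ ε hε => ?_) Φ ε hε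
  have hM : 0 ≤ μ.real (tsupport φ) := measureReal_nonneg
  -- Here `a` must nearly fix `φ(x)` after being moved by `α_x`, so it is chosen for the compact set
  -- of all `α_x⁻¹(φ(x))` with `x` in the support.
  obtain ⟨a, ha, haS⟩ := exists_approximateUnit_of_isCompact
    (φs.isCompact.image (T.continuous_symm_α φc))
    (show 0 < ε / 2 / (μ.real (tsupport φ) + 1) by positivity)
  -- Substituting `y = xz` in the convolution of `φ` with `h a` gives the integral of `h(z⁻¹) θ(z,
  -- x)` over `z`, and `h(z⁻¹) = h(z)` by symmetry. So `Φ * E` is an average of `θ z` near `z = 1`,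
  -- where `θ(1, x) = φ(x) α_x(a)` is close to `φ(x)`.
  let θ : G → G → A := fun z x => T.kernel (x * z) x (φ (x * z)) a
  have θc : Continuous (Function.uncurry θ) := T.continuous_kernel.comp
    (f := fun p : G × G => ((p.2 * p.1, p.2), (φ (p.2 * p.1), a))) (by fun_prop)
  have θs : ∀ K : Set G, IsCompact K →
      ∃ K' : Set G, IsCompact K' ∧ ∀ y ∈ K, ∀ x ∉ K', θ y x = 0 := fun K hK => by
    refine ⟨(fun p : G × G => p.1 * p.2⁻¹) '' (tsupport φ ×ˢ K),
      (IsCompact.prod φs hK).image (by fun_prop), fun y hy x hx => ?_⟩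
    have : φ (x * y) = 0 := image_eq_zero_of_notMem_tsupport fun h =>
      hx ⟨(x * y, y), ⟨h, hy⟩, by simp⟩
    simp only [θ, this, kernel_zero_left]
  have θi : ∀ z, Integrable (θ z) μ := fun z => by
    obtain ⟨K', hK', h0⟩ := θs {z} isCompact_singleton
    exact (θc.comp (continuous_const.prodMk continuous_id)).integrable_of_hasCompactSupport
      (HasCompactSupport.intro hK' fun x hx => h0 z rfl x hx)
  have hF := T.continuous_mkL1 μ θc θs θi
  obtain ⟨h, hc, hs, h0, hsym, h1, hle⟩ := exists_bump_near μ hF.continuousAt (g := 1)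
    (fun h hc hs => (hc.smul hF).integrable_of_hasCompactSupport hs.smul_right) (half_pos hε)
  simp only [one_mul] at hsym
  have ψc : Continuous fun y => h y • a := by fun_prop
  have ψs : HasCompactSupport fun y => h y • a := hs.smul_right
  have ψi := ψc.integrable_of_hasCompactSupport ψs (μ := μ)
  have hE : ‖T.mkL1 μ _ ψi‖ ≤ 1 := by
    rw [norm_mkL1, ← h1]
    refine integral_mono ψi.norm (hc.integrable_of_hasCompactSupport hs) fun x => ?_
    simp only [norm_smul, Real.norm_of_nonneg (h0 x)]
    exact mul_le_of_le_one_right (h0 x) ha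
  refine ⟨⟨_, hE⟩, ?_⟩
  let θ' : G → G → A := fun z x => h z • θ z x
  have θc' : Continuous (Function.uncurry θ') := (hc.comp continuous_fst).smul θc
  have θs' : HasCompactSupport (Function.uncurry θ') := by
    obtain ⟨K', hK', h0⟩ := θs _ hs
    refine HasCompactSupport.intro (IsCompact.prod hs hK') fun p hp => ?_
    by_contra hne
    have g1 : p.1 ∈ tsupport h :=
      subset_tsupport _ fun h0 => hne (by simp [θ', Function.uncurry, h0])
    exact hne (by simp [θ', Function.uncurry, h0 _ g1 _ fun h2 => hp ⟨g1, h2⟩])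
  have hI := continuous_integral_of_compact μ θc' θs'
  have hIi := hI.1.integrable_of_hasCompactSupport hI.2 (μ := μ)
  have e1 := (T.integral_mkL1 μ θc' θs' (fun z => (θi z).smul (h z)) hIi).2
  have e2 : Φ * T.mkL1 μ _ ψi = ∫ z, h z • T.mkL1 μ (θ z) (θi z) ∂μ := by
    have : ∀ z, h z • T.mkL1 μ (θ z) (θi z) = T.mkL1 μ (θ' z) ((θi z).smul (h z)) := fun z => by
      refine L1.ext' ?_
      rw [← Complex.coe_smul]
      filter_upwards [L1.coeFn_smul (h z : ℂ) (T.mkL1 μ (θ z) (θi z)), T.coeFn_mkL1 μ (θi z),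
        T.coeFn_mkL1 μ (f := θ' z) ((θi z).smul (h z))] with x g1 g2 g3
      rw [g1, g3, Pi.smul_apply, g2, Complex.coe_smul]
    simp_rw [this, e1]
    refine L1.ext' ((L1.coeFn_mul _ _).trans ?_)
    rw [T.conv_congr μ hΦ (T.coeFn_mkL1 μ ψi)]
    refine EventuallyEq.trans (Eventually.of_forall fun x => ?_) (T.coeFn_mkL1 μ hIi).symm
    rw [conv, ← integral_mul_left_eq_self _ x]
    refine integral_congr_ae (Eventually.of_forall fun z => ?_)
    simp only [θ', θ, mul_inv_rev, inv_mul_cancel_right, hsym]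
    rw [← Complex.coe_smul, ← Complex.coe_smul, kernel_smul_right]
  have e3 : ‖T.mkL1 μ (θ 1) (θi 1) - Φ‖ ≤ ε / 2 := by
    have e4 : ∀ x, θ 1 x = φ x * T.α x a := fun x => by
      simp only [θ, mul_one, kernel, inv_mul_cancel, T.ω_one_right]
      rfl
    refine (T.norm_mkL1_sub_le μ (θi 1) hΦ φs (fun x hx => ?_) fun x hx => ?_).trans
      (?_ : ε / 2 / (μ.real (tsupport φ) + 1) * _ ≤ _)
    · rw [e4, ← StarAlgEquiv.norm_map (T.α x).symm, map_sub, map_mul,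
        StarAlgEquiv.symm_apply_apply]
      exact (haS _ ⟨x, hx, rfl⟩).2
    · rw [e4, image_eq_zero_of_notMem_tsupport hx, zero_mul]
    · rw [div_mul_eq_mul_div, div_le_iff₀ (by positivity)]
      nlinarith
  rw [← e2] at hle
  have := norm_add_le (Φ * T.mkL1 μ _ ψi - T.mkL1 μ (θ 1) (θi 1)) (T.mkL1 μ (θ 1) (θi 1) - Φ)
  rw [sub_add_sub_cancel] at this
  linarith

/-! ### Closed ideals: invariance and testing by right multiplication. -/

section Ideal
variable {T μ} {I : Submodule ℂ (T.L1 μ)} (hI : ∀ Φ, ∀ Ψ ∈ I, Φ * Ψ ∈ I)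
  (hclosed : IsClosed (I : Set (T.L1 μ)))

omit [T2Space G] in
include hclosed in
theorem mem_of_forall_near {Ψ : T.L1 μ} (h : ∀ ε : ℝ, 0 < ε → ∃ Φ ∈ I, ‖Φ - Ψ‖ ≤ ε) : Ψ ∈ I := by
  have : Ψ ∈ closure (I : Set (T.L1 μ)) := Metric.mem_closure_iff.2 fun ε hε => by
    obtain ⟨Φ, hΦ, hle⟩ := h (ε / 2) (half_pos hε)
    refine ⟨Φ, hΦ, ?_⟩
    rw [dist_comm, dist_eq_norm]
    linarith
  rwa [hclosed.closure_eq] at this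

include hI hclosed in
theorem lam_coe_transl_mem (g : G) (a : A) {Ψ : T.L1 μ} (hΨ : Ψ ∈ I) :
    T.lam μ a (T.transl μ g Ψ) ∈ I :=
  mem_of_forall_near hclosed fun ε hε => by
    obtain ⟨E, hE⟩ := T.exists_mul_near μ g a Ψ hε
    exact ⟨E * Ψ, hI E Ψ hΨ, hE⟩

-- The factor `a` in `lam_coe_transl_mem` is removed by letting it run through an approximate unit
-- of `A`.
include hI hclosed in
theorem transl_mem (g : G) {Ψ : T.L1 μ} (hΨ : Ψ ∈ I) : T.transl μ g Ψ ∈ I :=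
  mem_of_forall_near hclosed fun ε hε => by
    obtain ⟨a, -, ha⟩ := T.exists_lam_near μ (T.transl μ g Ψ) hε
    exact ⟨_, lam_coe_transl_mem hI hclosed g a hΨ, ha⟩

-- `m Ψ` is approximated by `(m a) Ψ` with `m a` in `A`, which reduces to `lam_coe_transl_mem` at
-- the identity of `G`.
include hI hclosed in
theorem lam_mem (m : 𝓜(ℂ, A)) {Ψ : T.L1 μ} (hΨ : Ψ ∈ I) : T.lam μ m Ψ ∈ I :=
  mem_of_forall_near hclosed fun ε hε => by
    obtain ⟨a, -, ha⟩ := T.exists_lam_near μ Ψ (show 0 < ε / (‖m‖ + 1) by positivity)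
    refine ⟨T.lam μ m (T.lam μ a Ψ), ?_, ?_⟩
    · rw [← lam_mul, coe_mul_coe]
      have := lam_coe_transl_mem hI hclosed 1 (m.fst a) hΨ
      rwa [transl_one] at this
    · rw [← map_sub]
      refine (T.norm_lam_le μ m _).trans ((mul_le_mul_of_nonneg_left ha (norm_nonneg m)).trans ?_)
      rw [mul_div_assoc', div_le_iff₀ (by positivity)]
      nlinarith [norm_nonneg m]

-- Right approximate units recover `Φ` from its products; this gives the inclusion of the kernel of
-- the representation in `I`.
include hclosed in
theorem mem_of_forall_mul_mem {Φ : T.L1 μ} (h : ∀ E, Φ * E ∈ I) : Φ ∈ I :=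
  mem_of_forall_near hclosed fun ε hε => by
    obtain ⟨E, hE⟩ := T.exists_mul_right_near μ Φ hε
    exact ⟨Φ * E, h E, hE⟩

end Ideal
end TwistedAction

end

/-! ### The involution and its representation by adjoints. -/

section

open MeasureTheory Measure Topology Filter
open scoped NNReal ENNReal MultiplierAlgebra InnerProductSpace
open TwistedConvolution

namespace TwistedAction
variable {G A : Type*} [Group G] [TopologicalSpace G] [IsTopologicalGroup G]
  [LocallyCompactSpace G] [T2Space G] [MeasurableSpace G] [BorelSpace G]
  [NonUnitalCStarAlgebra A] (T : TwistedAction G A)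
  (μ : Measure G) [μ.IsHaarMeasure] [μ.Regular]

-- The constant is that of `map_inv_withDensity_le`. Any bound suffices, as only continuity of the
-- involution is needed.
omit [T2Space G] in
theorem exists_norm_star_le : ∃ c : ℝ, ∀ Φ : T.L1 μ, ‖star Φ‖ ≤ c * ‖Φ‖ := by
  obtain ⟨c, hc⟩ := map_inv_withDensity_le μ
  refine ⟨c, fun Φ => ?_⟩
  have hm := continuous_modularCharacterFun (G := G)
  have h1 : ‖star Φ‖ ≤ ∫ x, modularCharacterFun x • ‖Φ x⁻¹‖ ∂μ := by
    have h0 : ‖star Φ‖ = ∫ x, ‖T.starFun Φ x‖ ∂μ := by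
      rw [L1.norm_eq]
      exact integral_congr_ae ((L1.coeFn_star Φ).mono fun x hx => by simp only [hx])
    rw [h0]
    refine integral_mono (T.integrable_starFun μ Φ.integrable).norm
      (integrable_modular_smul_inv μ Φ.integrable.norm) fun x => ?_
    simp only [starFun, NNReal.smul_def, norm_smul, Real.norm_of_nonneg (NNReal.coe_nonneg _)]
    refine smul_le_smul_of_nonneg_left ?_ (NNReal.coe_nonneg _)
    refine (norm_fst_le (star (T.ω x x⁻¹)) _).trans ?_
    rw [StarAlgEquiv.norm_map, norm_star]
  refine h1.trans ?_
  have h2 := (Homeomorph.inv G).measurableEmbedding.integral_map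
    (μ := μ.withDensity fun x => (modularCharacterFun x : ℝ≥0∞)) fun x => ‖Φ x‖
  have h3 := integral_withDensity_eq_integral_smul (μ := μ) hm.measurable fun x => ‖Φ x⁻¹‖
  rw [← h3, L1.norm_eq]
  refine (h2.symm.le.trans (integral_mono_measure hc (Eventually.of_forall fun x => norm_nonneg _)
    Φ.integrable.norm.smul_measure_nnreal)).trans_eq ?_
  rw [integral_smul_nnreal_measure, NNReal.smul_def, smul_eq_mul]

omit [T2Space G] in
theorem star_add' (Φ Ψ : T.L1 μ) : star (Φ + Ψ) = star Φ + star Ψ := by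
  refine L1.ext' ?_
  filter_upwards [L1.coeFn_star (Φ + Ψ), L1.coeFn_star Φ, L1.coeFn_star Ψ,
    L1.coeFn_add (star Φ) (star Ψ), (tendsto_inv_ae μ).eventually (L1.coeFn_add Φ Ψ)]
    with x h1 h2 h3 h4 h5
  rw [h1, h4, Pi.add_apply, h2, h3]
  simp [starFun, h5]

omit [T2Space G] in
theorem continuous_star_L1 : Continuous fun Φ : T.L1 μ => star Φ := by
  obtain ⟨c, hc⟩ := T.exists_norm_star_le μ
  exact AddMonoidHomClass.continuous_of_bound
    (AddMonoidHom.mk' (fun Φ : T.L1 μ => star Φ) (T.star_add' μ)) c hc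

omit [T2Space G] [MeasurableSpace G] [BorelSpace G] in
theorem continuous_starFun [MeasurableSpace G] [BorelSpace G] {φ : G → A} (hφ : Continuous φ) :
    Continuous (T.starFun φ) := by
  have h1 : Continuous fun x => star (T.α x (star (φ x⁻¹))) :=
    (T.continuous_α_prod.comp (f := fun x : G => (x, star (φ x⁻¹))) (by fun_prop)).star
  have h2 := T.continuous_ω_right_prod.comp
    (f := fun x : G => ((x, x⁻¹), star (T.α x (star (φ x⁻¹))))) (by fun_prop)
  have h3 : T.starFun φ = fun x => modularCharacterFun x •
      star ((T.ω x x⁻¹ : 𝓜(ℂ, A)).snd (star (T.α x (star (φ x⁻¹))))) := by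
    ext x
    simp only [starFun, DoubleCentralizer.star_fst]
  rw [h3]
  exact (continuous_modularCharacterFun (G := G)).smul h2.star

omit [T2Space G] [MeasurableSpace G] [BorelSpace G] in
theorem hasCompactSupport_starFun [MeasurableSpace G] [BorelSpace G] {φ : G → A}
    (hφ : HasCompactSupport φ) : HasCompactSupport (T.starFun φ) := by
  refine (hφ.comp_homeomorph (Homeomorph.inv G)).mono fun x hx h0 => hx ?_
  have : φ x⁻¹ = 0 := h0
  simp [starFun, this]

section Representation
variable {T μ} {H : Type*} [NormedAddCommGroup H] [InnerProductSpace ℂ H] [FiniteDimensional ℂ H]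
  {q : T.L1 μ →L[ℂ] H} (hq : Function.Surjective q)
  {ρ : 𝓜(ℂ, A) → H →L[ℂ] H} (hρ : ∀ m Ψ, ρ m (q Ψ) = q (T.lam μ m Ψ))
  {W : G → H →L[ℂ] H} (hW : ∀ g Ψ, W g (q Ψ) = q (T.transl μ g Ψ))
  (hρu : ∀ (u : unitary 𝓜(ℂ, A)) v, ‖ρ u v‖ = ‖v‖) (hWu : ∀ g v, ‖W g v‖ = ‖v‖)

include hq hρ hρu

-- For a unitary `u`, the isometry `ρ u` has left inverse its adjoint and right inverse `ρ (star
-- u)`, so these agree. Unitaries span the unital C*-algebra of multipliers, and both sides are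
-- conjugate-linear.
omit [T2Space G] [FiniteDimensional ℂ H] in
theorem rep_star_multiplier [CompleteSpace H] (m : 𝓜(ℂ, A)) : ρ (star m) = star (ρ m) := by
  have hmul : ∀ m n, ρ (m * n) = ρ m * ρ n := fun m n => ContinuousLinearMap.ext fun v => by
    obtain ⟨Ψ, rfl⟩ := hq v
    rw [hρ, lam_mul, mul_apply_eq_comp, hρ, hρ]
  have hone : ρ 1 = 1 := ContinuousLinearMap.ext fun v => by
    obtain ⟨Ψ, rfl⟩ := hq v
    rw [hρ, lam_one, one_apply_eq_self]
  have hadd : ∀ m n, ρ (m + n) = ρ m + ρ n := fun m n => ContinuousLinearMap.ext fun v => by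
    obtain ⟨Ψ, rfl⟩ := hq v
    rw [hρ, _root_.add_apply, hρ, hρ, map_add, _root_.add_apply, map_add]
  have hsmul : ∀ (c : ℂ) m, ρ (c • m) = c • ρ m := fun c m => ContinuousLinearMap.ext fun v => by
    obtain ⟨Ψ, rfl⟩ := hq v
    rw [hρ, _root_.smul_apply, hρ, map_smul, _root_.smul_apply, map_smul]
  have hu : ∀ u : unitary 𝓜(ℂ, A), ρ (star (u : 𝓜(ℂ, A))) = star (ρ (u : 𝓜(ℂ, A))) := fun u => by
    have h1 : star (ρ u) * ρ u = 1 :=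
      (ContinuousLinearMap.norm_map_iff_adjoint_comp_self _).1 (hρu u)
    have h2 : ρ u * ρ (star (u : 𝓜(ℂ, A))) = 1 := by
      rw [← hmul, Unitary.mul_star_self_of_mem u.2, hone]
    exact (left_inv_eq_right_inv h1 h2).symm
  have hm : m ∈ Submodule.span ℂ (unitary 𝓜(ℂ, A) : Set 𝓜(ℂ, A)) := by
    rw [CStarAlgebra.span_unitary]
    trivial
  induction hm using Submodule.span_induction with
  | mem u hu' => exact hu ⟨u, hu'⟩
  | zero =>
    have : ρ 0 = 0 := by simpa using hsmul 0 0
    rw [star_zero, this, star_zero]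
  | add m n _ _ h1 h2 => rw [star_add, hadd, hadd, star_add, h1, h2]
  | smul c m _ h1 => rw [star_smul, hsmul, hsmul, star_smul, h1]

include hW hWu

-- By `transl_transl`, `W y⁻¹` is invertible with inverse `ρ(ω(y,y⁻¹)^*) W y`; being isometric, its
-- inverse is its adjoint. Moving `ρ(b^*)` past `W y` then produces `α_y(b^*)`. The result is the
-- integrand of `starFun` apart from the modular factor.
omit [T2Space G] [FiniteDimensional ℂ H] in
theorem rep_star_mul_transl [CompleteSpace H] (y : G) (b : A) :
    star (ρ b * W y⁻¹) =
      ρ ((star (T.ω y y⁻¹ : 𝓜(ℂ, A))).fst (T.α y (star b)) : A) * W y := by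
  have hstar := rep_star_multiplier hq hρ hρu
  have hmul : ∀ m n, ρ (m * n) = ρ m * ρ n := fun m n => ContinuousLinearMap.ext fun v => by
    obtain ⟨Ψ, rfl⟩ := hq v
    rw [hρ, lam_mul, mul_apply_eq_comp, hρ, hρ]
  have hone : ρ 1 = 1 := ContinuousLinearMap.ext fun v => by
    obtain ⟨Ψ, rfl⟩ := hq v
    rw [hρ, lam_one, one_apply_eq_self]
  have hWW : ∀ g h, W g * W h = ρ (T.ω g h) * W (g * h) := fun g h =>
    ContinuousLinearMap.ext fun v => by
      obtain ⟨Ψ, rfl⟩ := hq v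
      simp only [mul_apply_eq_comp, hW, hρ, transl_transl]
  have hW1 : W 1 = 1 := ContinuousLinearMap.ext fun v => by
    obtain ⟨Ψ, rfl⟩ := hq v
    rw [hW, transl_one, one_apply_eq_self]
  have hWρ : W y * ρ (star b : A) = ρ (T.α y (star b) : A) * W y :=
    ContinuousLinearMap.ext fun v => by
      obtain ⟨Ψ, rfl⟩ := hq v
      simp only [mul_apply_eq_comp, hW, hρ, transl_lam]
  have e1 : W y * W y⁻¹ = ρ (T.ω y y⁻¹) := by rw [hWW, mul_inv_cancel, hW1, mul_one]
  have e2 : W y⁻¹ * W y = ρ (T.ω y⁻¹ y) := by rw [hWW, inv_mul_cancel, hW1, mul_one]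
  have e3 : star (W y⁻¹) * W y⁻¹ = 1 :=
    (ContinuousLinearMap.norm_map_iff_adjoint_comp_self _).1 (hWu y⁻¹)
  have e4 : W y⁻¹ * (W y * ρ (star (T.ω y⁻¹ y : 𝓜(ℂ, A)))) = 1 := by
    rw [← mul_assoc, e2, ← hmul, Unitary.mul_star_self_of_mem (T.ω y⁻¹ y).2, hone]
  have e5 : ρ (star (T.ω y y⁻¹ : 𝓜(ℂ, A))) * W y * W y⁻¹ = 1 := by
    rw [mul_assoc, e1, ← hmul, Unitary.coe_star_mul_self, hone]
  -- `e3` and `e5` give two left inverses of `W y⁻¹`, and `e4` a right inverse, so all three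
  -- coincide.
  have e6 : star (W y⁻¹) = ρ (star (T.ω y y⁻¹ : 𝓜(ℂ, A))) * W y :=
    (left_inv_eq_right_inv e3 e4).trans (left_inv_eq_right_inv e5 e4).symm
  have e7 : star (b : 𝓜(ℂ, A)) = ((star b : A) : 𝓜(ℂ, A)) :=
    (map_star (DoubleCentralizer.coeHom (𝕜 := ℂ) (A := A)) b).symm
  rw [star_mul, e6, ← hstar, e7, mul_assoc, hWρ, ← mul_assoc, ← hmul, coe_mul_coe]

variable {π : T.L1 μ → H →L[ℂ] H} (hπ : ∀ Φ Ψ, π Φ (q Ψ) = q (Φ * Ψ))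

include hπ

/-- A finite-dimensional representation in which unitary multipliers and translations act
isometrically is a *-representation. -/
theorem rep_star [CompleteSpace H] (Φ : T.L1 μ) : π (star Φ) = star (π Φ) := by
  -- In finite dimension, norm continuity of operators can be tested on vectors, here on `q Ψ`.
  have hπc : Continuous π := continuous_clm_apply.2 fun v => by
    obtain ⟨Ψ, rfl⟩ := hq v
    simp only [hπ]
    fun_prop
  refine L1.induction_compact (P := fun Φ => π (star Φ) = star (π Φ))
    (isClosed_eq (hπc.comp (T.continuous_star_L1 μ)) hπc.star) (fun φ φc φs Φ hΦ => ?_) Φ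
  -- The image under `q` of the integral formula for the product: `π` is the integrated form of `ρ`
  -- and `W`.
  have hint : ∀ {φ : G → A} (φc : Continuous φ) (φs : HasCompactSupport φ) {Φ : T.L1 μ}
      (hΦ : Φ =ᵐ[μ] φ) (v : H), Integrable (fun y => (ρ (φ y : A) * W y) v) μ ∧
        π Φ v = ∫ y, (ρ (φ y : A) * W y) v ∂μ := by
    intro φ φc φs Φ hΦ v
    obtain ⟨Ψ, rfl⟩ := hq v
    obtain ⟨h1, h2⟩ := T.mul_eq_integral μ φc φs hΦ Ψ
    simp only [mul_apply_eq_comp, hW, hρ, hπ]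
    exact ⟨q.integrable_comp h1, by rw [h2, q.integral_comp_comm h1]⟩
  have hstarΦ : ⇑(star Φ) =ᵐ[μ] T.starFun φ := by
    filter_upwards [L1.coeFn_star Φ, (tendsto_inv_ae μ).eventually hΦ] with x h1 h2
    rw [h1, starFun, starFun, h2]
  have hKc : Continuous fun y => ρ (φ y : A) * W y := continuous_clm_apply.2 fun v => by
    obtain ⟨Ψ, rfl⟩ := hq v
    simp only [mul_apply_eq_comp, hW, hρ]
    exact q.continuous.comp (((T.lam μ).continuous.comp (continuous_coe.comp φc)).clm_apply
      (T.continuous_transl μ Ψ))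
  have hKs : HasCompactSupport fun y => ρ (φ y : A) * W y :=
    HasCompactSupport.intro φs fun y hy => ContinuousLinearMap.ext fun v => by
      obtain ⟨Ψ, rfl⟩ := hq v
      rw [image_eq_zero_of_notMem_tsupport hy, mul_apply_eq_comp, hW, hρ,
        lam_coe_zero, map_zero, _root_.zero_apply]
  refine ContinuousLinearMap.ext fun v => ext_inner_left ℂ fun w => ?_
  have hfc : Continuous fun y => star (ρ (φ y : A) * W y) v :=
    hKc.star.clm_apply continuous_const
  have hfs : HasCompactSupport fun y => star (ρ (φ y : A) * W y) v :=
    hKs.mono fun y hy h0 => hy (by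
      have : ρ (φ y : A) * W y = 0 := h0
      simp [this])
  -- Replacing `y` by `y⁻¹` produces the modular factor of `starFun`, and `rep_star_mul_transl`
  -- matches the remaining factors.
  have e1 : π (star Φ) v = ∫ y, star (ρ (φ y : A) * W y) v ∂μ := by
    rw [← integral_modular_smul_inv μ hfc hfs,
      (hint (T.continuous_starFun φc) (T.hasCompactSupport_starFun φs) hstarΦ v).2]
    refine integral_congr_ae (Eventually.of_forall fun y => ?_)
    simp only
    rw [rep_star_mul_transl hq hρ hW hρu hWu, starFun, NNReal.smul_def, NNReal.smul_def,
      ← Complex.coe_smul, ← Complex.coe_smul]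
    obtain ⟨Ψ, rfl⟩ := hq v
    have : ∀ (c : ℂ) (a : A), ((c • a : A) : 𝓜(ℂ, A)) = c • (a : 𝓜(ℂ, A)) :=
      map_smul (DoubleCentralizer.coeHom (𝕜 := ℂ) (A := A))
    simp only [mul_apply_eq_comp, hW, hρ, this, map_smul, _root_.smul_apply]
  have hfi := hfc.integrable_of_hasCompactSupport hfs (μ := μ)
  obtain ⟨g1, g2⟩ := hint φc φs hΦ w
  rw [e1, ContinuousLinearMap.star_eq_adjoint, ContinuousLinearMap.adjoint_inner_right, g2,
    ← integral_inner hfi w, ← inner_conj_symm, ← integral_inner g1 v, ← integral_conj]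
  refine integral_congr_ae (Eventually.of_forall fun y => ?_)
  simp only
  rw [ContinuousLinearMap.star_eq_adjoint, ContinuousLinearMap.adjoint_inner_right,
    inner_conj_symm]

end Representation
end TwistedAction

end

/-! ### The *-representation on the quotient, and its consequences. -/

section

open MeasureTheory Measure Topology Filter
open scoped NNReal ENNReal MultiplierAlgebra InnerProductSpace
open TwistedConvolution

namespace TwistedConvolution

/-- Lift `v` to an element of norm less than `‖v‖ + ε` and apply `f` there. -/
theorem norm_mapQ_le {E : Type*} [SeminormedAddCommGroup E] [Module ℂ E] (I : Submodule ℂ E)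
    (f : E →ₗ[ℂ] E) (hf : I ≤ I.comap f) (h : ∀ x, ‖f x‖ ≤ ‖x‖) (v : E ⧸ I) :
    ‖I.mapQ I f hf v‖ ≤ ‖v‖ := by
  refine le_of_forall_pos_lt_add fun ε hε => ?_
  obtain ⟨x, rfl, hx⟩ := QuotientAddGroup.exists_norm_mk_lt (S := I.toAddSubgroup) v hε
  exact ((Submodule.Quotient.norm_mk_le I (f x)).trans (h x)).trans_lt hx

/-- A ring is semisimple if it has a faithful homomorphism to a C*-algebra with *-invariant
image; here the ring is given as a quotient. -/
theorem isSemisimple_quotientRing {B : Type*} [NonUnitalRing B] [Module ℂ B] [Star B]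
    {I : Submodule ℂ B} (hI : IsTwoSidedIdeal I) {C : Type*} [CStarAlgebra C]
    (π : B →⋆ₙₐ[ℂ] C) (hπ : ∀ b, π b = 0 ↔ b ∈ I) : IsSemisimple (QuotientRing hI) := by
  have heq : ∀ x y : B, (x : QuotientRing hI) = y ↔ π x = π y := fun x y => by
    rw [RingCon.eq, TwoSidedIdeal.rel_iff, TwoSidedIdeal.mem_mk', SetLike.mem_coe, ← hπ, map_sub,
      sub_eq_zero]
  refine Set.eq_singleton_iff_unique_mem.2 ⟨fun b => ?_, fun r hr => ?_⟩
  · rw [mul_zero]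
    exact isQuasiregular_iff.2 ⟨0, by simp⟩
  · obtain ⟨Φ, rfl⟩ := Quotient.mk''_surjective r
    change (Φ : QuotientRing hI) = (0 : B)
    rw [heq, map_zero]
    by_contra h0
    -- A nonzero self-adjoint element has spectral radius equal to its norm, hence a nonzero
    -- spectral value `k`.
    set c := star (π Φ) * π Φ with hc
    have hc0 : c ≠ 0 := fun h => h0 (CStarRing.star_mul_self_eq_zero_iff _ |>.1 h)
    have : Nontrivial C := ⟨⟨c, 0, hc0⟩⟩
    obtain ⟨k, hk, hkn⟩ := spectrum.exists_nnnorm_eq_spectralRadius c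
    rw [(IsSelfAdjoint.star_mul_self (π Φ)).spectralRadius_eq_nnnorm] at hkn
    have hk0 : k ≠ 0 := by
      rintro rfl
      simp only [nnnorm_zero, ENNReal.coe_zero] at hkn
      exact hc0 (nnnorm_eq_zero.1 (by exact_mod_cast hkn.symm))
    -- Quasi-regularity of the multiple `-k⁻¹ Φ^* Φ` makes `1 - k⁻¹c`, and so `k - c`, invertible,
    -- contradicting the choice of `k`.
    obtain ⟨y, hy1, hy2⟩ := isQuasiregular_iff.1
      (hr (((-k⁻¹) • star Φ : B) : QuotientRing hI))
    obtain ⟨Ψ, rfl⟩ := Quotient.mk''_surjective y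
    have g1 := (heq (Ψ + (-k⁻¹) • star Φ * Φ + (-k⁻¹) • star Φ * Φ * Ψ) 0).1 hy1
    have g2 := (heq ((-k⁻¹) • star Φ * Φ + Ψ + Ψ * ((-k⁻¹) • star Φ * Φ)) 0).1 hy2
    simp only [map_add, map_mul, map_smul, map_star, map_zero, smul_mul_assoc, ← hc] at g1 g2
    set z := π Ψ
    have hu : IsUnit (1 + (-k⁻¹) • c) := by
      refine ⟨⟨1 + (-k⁻¹) • c, 1 + z, ?_, ?_⟩, rfl⟩
      · rw [add_mul, one_mul, mul_add, mul_one, add_assoc, smul_mul_assoc, ← add_assoc z, g1,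
          add_zero]
      · rw [mul_add, mul_one, add_mul, one_mul, add_assoc]
        have : z + ((-k⁻¹) • c + z * (-k⁻¹) • c) = 0 := by
          rw [← g2]; abel
        rw [this, add_zero]
    apply hk
    have e : algebraMap ℂ C k - c = k • (1 + (-k⁻¹) • c) := by
      rw [smul_add, smul_smul, mul_neg, mul_inv_cancel₀ hk0, Algebra.algebraMap_eq_smul_one,
        neg_smul, one_smul, sub_eq_add_neg]
    change IsUnit _
    rw [e]
    exact (isUnit_smul_iff (Units.mk0 k hk0) _).2 hu

/-- The range of a *-homomorphism into a finite-dimensional C*-algebra is a C*-algebra. -/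
theorem exists_surjective_starHom {B : Type*} [NonUnitalRing B] [Module ℂ B] [Star B]
    {C : Type w} [CStarAlgebra C] [FiniteDimensional ℂ C] (π : B →⋆ₙₐ[ℂ] C) :
    ∃ (D : Type w) (_ : NonUnitalCStarAlgebra D) (π' : B →⋆ₙₐ[ℂ] D),
      FiniteDimensional ℂ D ∧ Function.Surjective π' ∧ ∀ b, π' b = 0 ↔ π b = 0 := by
  let S : NonUnitalStarSubalgebra ℂ C := NonUnitalStarAlgHom.range π
  have hfd : FiniteDimensional ℂ S.toSubmodule := inferInstance
  -- Closedness is what makes the range a C*-algebra in its own right.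
  have hS : IsClosed (S : Set C) := S.toSubmodule.closed_of_finiteDimensional
  refine ⟨S, inferInstance, NonUnitalStarAlgHom.rangeRestrict π, hfd, ?_, fun b => ?_⟩
  · rintro ⟨_, b, rfl⟩
    exact ⟨b, rfl⟩
  · exact Subtype.ext_iff

end TwistedConvolution

namespace TwistedAction
variable {G A : Type*} [Group G] [TopologicalSpace G] [IsTopologicalGroup G]
  [LocallyCompactSpace G] [T2Space G] [MeasurableSpace G] [BorelSpace G]
  [NonUnitalCStarAlgebra A] (T : TwistedAction G A)
  (μ : Measure G) [μ.IsHaarMeasure] [μ.Regular]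

/-- A closed two-sided ideal of finite codimension in `L¹(G, A)` is the kernel of a *-representation
on a finite-dimensional Hilbert space. -/
theorem exists_rep (I : Submodule ℂ (T.L1 μ)) (hI : IsTwoSidedIdeal I)
    (hclosed : IsClosed (I : Set (T.L1 μ))) [FiniteDimensional ℂ (T.L1 μ ⧸ I)] :
    ∃ (n : ℕ) (π : T.L1 μ →⋆ₙₐ[ℂ] (EuclideanSpace ℂ (ULift.{w} (Fin n)) →L[ℂ]
      EuclideanSpace ℂ (ULift.{w} (Fin n)))), ∀ Φ, π Φ = 0 ↔ Φ ∈ I := by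
  have hl : ∀ Φ, ∀ Ψ ∈ I, Φ * Ψ ∈ I := fun Φ Ψ h => (hI Φ Ψ h).1
  obtain ⟨n, e, he⟩ := exists_invariant_euclidean.{_, w} (T.L1 μ ⧸ I)
  let H := EuclideanSpace ℂ (ULift.{w} (Fin n))
  let op : Module.End ℂ (T.L1 μ ⧸ I) ≃ₐ[ℂ] (H →L[ℂ] H) :=
    (e.conjAlgEquiv ℂ).trans (Module.End.toContinuousLinearMap H)
  have hop : ∀ k v, op k (e v) = e (k v) := fun k v => by
    change e (k (e.symm (e v))) = _
    rw [e.symm_apply_apply]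
  let q : T.L1 μ →L[ℂ] H := e.toContinuousLinearEquiv.toContinuousLinearMap ∘L
    I.mkQ.mkContinuous 1 fun Ψ => by
      rw [one_mul]
      exact Submodule.Quotient.norm_mk_le I Ψ
  have hqe : ∀ Ψ, q Ψ = e (I.mkQ Ψ) := fun Ψ => rfl
  have hq : Function.Surjective q := fun v => by
    obtain ⟨Ψ, hΨ⟩ := I.mkQ_surjective (e.symm v)
    exact ⟨Ψ, by rw [hqe, hΨ, e.apply_symm_apply]⟩
  have hq0 : ∀ Ψ, q Ψ = 0 ↔ Ψ ∈ I := fun Ψ => by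
    rw [hqe, map_eq_zero_iff e e.injective, Submodule.mkQ_apply, Submodule.Quotient.mk_eq_zero]
  let D : (f : T.L1 μ →L[ℂ] T.L1 μ) → (∀ Ψ ∈ I, f Ψ ∈ I) → Module.End ℂ (T.L1 μ ⧸ I) :=
    fun f hf => I.mapQ I f.toLinearMap hf
  have hD : ∀ f hf Ψ, op (D f hf) (q Ψ) = q (f Ψ) := fun f hf Ψ => by
    rw [hqe, hop, hqe]
    rfl
  have hDnorm : ∀ f hf, (∀ Ψ, ‖f Ψ‖ ≤ ‖Ψ‖) → ∀ v, ‖D f hf v‖ ≤ ‖v‖ := fun f hf h v =>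
    norm_mapQ_le I f.toLinearMap hf h v
  have hiso : ∀ k : Module.End ℂ (T.L1 μ ⧸ I), (∀ v, ‖k v‖ = ‖v‖) → ∀ v, ‖op k v‖ = ‖v‖ :=
    fun k hk v => by
      obtain ⟨v, rfl⟩ := e.surjective v
      rw [hop]
      exact he k hk v
  let ρ' : 𝓜(ℂ, A) → Module.End ℂ (T.L1 μ ⧸ I) := fun m =>
    D (T.lam μ m) fun Ψ hΨ => lam_mem hl hclosed m hΨ
  let W' : G → Module.End ℂ (T.L1 μ ⧸ I) := fun g =>
    D (T.transl μ g) fun Ψ hΨ => transl_mem hl hclosed g hΨ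
  have hρle : ∀ (u : unitary 𝓜(ℂ, A)) v, ‖ρ' u v‖ ≤ ‖v‖ := fun u v =>
    hDnorm _ _ (fun Ψ => (T.norm_lam_le μ u Ψ).trans
      (mul_le_of_le_one_left (norm_nonneg _) (norm_unitary_le u))) v
  -- A contraction whose inverse `ρ' (star u)` is also a contraction is isometric.
  have hρu : ∀ (u : unitary 𝓜(ℂ, A)) v, ‖ρ' u v‖ = ‖v‖ := fun u v => by
    refine le_antisymm (hρle u v) ?_
    have h1 : ρ' (star u : unitary 𝓜(ℂ, A)) (ρ' u v) = v := by
      obtain ⟨Ψ, rfl⟩ := I.mkQ_surjective v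
      change I.mkQ (T.lam μ (star u : unitary 𝓜(ℂ, A)) (T.lam μ u Ψ)) = I.mkQ Ψ
      rw [← lam_mul, Unitary.coe_star, Unitary.coe_star_mul_self, lam_one]
    calc ‖v‖ = ‖ρ' (star u : unitary 𝓜(ℂ, A)) (ρ' u v)‖ := by rw [h1]
      _ ≤ _ := hρle _ _
  have hWle : ∀ g v, ‖W' g v‖ ≤ ‖v‖ := fun g v => hDnorm _ _ (fun Ψ => T.norm_transl_le μ g Ψ) v
  have hWu : ∀ g v, ‖W' g v‖ = ‖v‖ := fun g v => by
    refine le_antisymm (hWle g v) ?_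
    -- Translation by `g⁻¹` inverts translation by `g` only up to a unitary multiplier, which is
    -- already known to be isometric.
    have h1 : W' g⁻¹ (W' g v) = ρ' (T.ω g⁻¹ g) v := by
      obtain ⟨Ψ, rfl⟩ := I.mkQ_surjective v
      change I.mkQ (T.transl μ g⁻¹ (T.transl μ g Ψ)) = I.mkQ (T.lam μ _ Ψ)
      rw [transl_transl, inv_mul_cancel, transl_one]
    calc ‖v‖ = ‖W' g⁻¹ (W' g v)‖ := by rw [h1, hρu]
      _ ≤ _ := hWle _ _
  let π : T.L1 μ → H →L[ℂ] H := fun Φ => op (D (L1.mulL Φ) (hl Φ))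
  have hπ : ∀ Φ Ψ, π Φ (q Ψ) = q (Φ * Ψ) := fun Φ Ψ => hD _ _ Ψ
  have hext : ∀ {S S' : H →L[ℂ] H}, (∀ Ψ, S (q Ψ) = S' (q Ψ)) → S = S' := fun h =>
    ContinuousLinearMap.ext fun v => by
      obtain ⟨Ψ, rfl⟩ := hq v
      exact h Ψ
  refine ⟨n,
    { toFun := π
      map_smul' := fun c Φ => hext fun Ψ => by
        rw [hπ, smul_mul_assoc, map_smul, ← hπ]
        rfl
      map_zero' := hext fun Ψ => by
        rw [hπ, zero_mul, map_zero]
        rfl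
      map_add' := fun Φ Φ' => hext fun Ψ => by
        rw [hπ, add_mul, map_add, ← hπ, ← hπ]
        rfl
      map_mul' := fun Φ Φ' => hext fun Ψ => by
        rw [hπ, mul_assoc, ← hπ, ← hπ]
        rfl
      map_star' := fun Φ => rep_star hq (ρ := fun m => op (ρ' m)) (fun m Ψ => hD _ _ Ψ)
        (W := fun g => op (W' g)) (fun g Ψ => hD _ _ Ψ) (fun u => hiso _ (hρu u))
        (fun g => hiso _ (hWu g)) hπ Φ }, fun Φ => ?_⟩
  change π Φ = 0 ↔ _
  constructor
  -- `π Φ = 0` says that `Φ * E ∈ I` for every `E`. The converse below uses that `I` is a right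
  -- ideal.
  · refine fun h => mem_of_forall_mul_mem hclosed fun E => ?_
    rw [← hq0, ← hπ, h]
    rfl
  · refine fun h => hext fun Ψ => ?_
    rw [hπ, (hq0 _).2 (hI Ψ Φ h).2]
    rfl

end TwistedAction

end

/-- Let `(G, α, ω, A)` be a twisted action of a locally compact group on a C*-algebra. Every closed
two-sided ideal `I` of finite codimension in the twisted convolution algebra `L¹(G, A)` is a
*-ideal, the quotient algebra is semisimple, and it is *-isomorphic to a finite-dimensional
C*-algebra. -/
theorem theorem1 {G : Type u} {A : Type v} [Group G] [TopologicalSpace G] [IsTopologicalGroup G]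
    [LocallyCompactSpace G] [T2Space G] [MeasurableSpace G] [BorelSpace G]
    (μ : MeasureTheory.Measure G) [μ.IsHaarMeasure] [μ.Regular]
    [NonUnitalCStarAlgebra A] (T : TwistedAction G A)
    (I : Submodule ℂ (T.L1 μ)) (hI : TwistedConvolution.IsTwoSidedIdeal I)
    (hclosed : IsClosed (I : Set (T.L1 μ))) (hfin : FiniteDimensional ℂ (T.L1 μ ⧸ I)) :
    (∀ Φ ∈ I, star Φ ∈ I) ∧
    TwistedConvolution.IsSemisimple (TwistedConvolution.QuotientRing hI) ∧
    ∃ (C : Type (max u v)) (_ : NonUnitalCStarAlgebra C) (π : T.L1 μ →⋆ₙₐ[ℂ] C),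
      FiniteDimensional ℂ C ∧ Function.Surjective π ∧ ∀ Φ : T.L1 μ, π Φ = 0 ↔ Φ ∈ I := by
  -- The Hilbert space is taken in the universe demanded of the C*-algebra, which is the range of
  -- `π` inside its operators.
  obtain ⟨n, π, hπ⟩ := TwistedAction.exists_rep.{_, _, max u v} T μ I hI hclosed
  obtain ⟨C, hC, π', hfd, hsurj, hker⟩ := TwistedConvolution.exists_surjective_starHom π
  have hπ' : ∀ Φ, π' Φ = 0 ↔ Φ ∈ I := fun Φ => (hker Φ).trans (hπ Φ)
  refine ⟨fun Φ hΦ => ?_, TwistedConvolution.isSemisimple_quotientRing hI π hπ,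
    C, hC, π', hfd, hsurj, hπ'⟩
  rw [← hπ', map_star, (hπ' Φ).2 hΦ, star_zero]
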